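/- **Conventions.** All graphs are finite and simple. A connected graph with $n$ vertices and $n+1$ edges is called bicyclic. A non-increasing sequence $\pi=(d_1,\dots,d_n)$ is a bicyclic degree sequence if it is the degree sequence of some bicyclic graph, and $\Gamma(\pi)$ denotes the class of connected graphs with degree sequence $\pi$. The symbol $p^{(q)}$ means $q$ copies of $p$. A real-valued function $f(x,y)$ of two positive real variables with $f(x,y)=f(y,x)$ is escalating if $$f(x_1,x_2)+f(y_1,y_2)\ \ge\ f(x_2,y_1)+f(x_1,y_2)\qquad\text{for all } x_1\ge y_1>0,\ x_2\ge y_2>0,$$ with strict inequality whenever $x_1>y_1$ and $x_2>y_2$; it is de-escalating if the reversed inequalities hold. Put $M_f(G)=\sum_{uv\in E(G)}f(d(u),d(v))$. A BFS-ordering of a connected graph $G$ is an ordering $v_1\prec v_2\prec\dots\prec v_n$ of $V(G)$ such that, with $h(v)$ the distance from $v$ to $v_1$: (a) $d(v_1)\ge\dots\ge d(v_n)$ and $h(v_1)\le\dots\le h(v_n)$; (b) if $v\in N(u)\setminus N(w)$, $z\in N(w)\setminus N(u)$, $h(u)=h(w)=h(v)-1=h(z)-1$ and $u\prec w$, then $v\prec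 z$. The base graph $\mathcal R(G)$ is obtained from $G$ by recursively deleting pendant vertices until none remain. **Graphs.** $B_1$ consists of two triangles sharing exactly one edge, $B_2$ of two triangles sharing exactly one vertex. A graph $B_3$ consists of two cycles sharing exactly one vertex, and a graph $B_5$ of two cycles sharing exactly one edge together with its two ends (the cycles may have any lengths $\ge 3$). **Construction.** Let $\pi=(d_1,\dots,d_n)$ be a bicyclic degree sequence. A graph $B$ is called a graph $B_M(\pi)$ in each of the following cases. 1. $d_1\ge d_2\ge 3$ and $d_n=1$: $B$ has a BFS-ordering $v_1\prec\dots\prec v_n$ with $d(v_i)=d_i$ for all $i$, and $\mathcal R(B)\cong B_1$ has vertex set $\{v_1,v_2,v_3,v_4\}$ and consists of the triangles $v_1v_2v_3$ and $v_1v_2v_4$. 2. $d_1\ge 5>d_2=2$ and $d_n=1$: $B$ is a graph with $n$ vertices obtained from $B_2$ by attaching $d_1-4$ non-empty paths, whose numbers of vertices pairwise differ by at most $1$, to the vertex of degree four of $B_2$ (each path by an edge from one of its ends). 3. $\pi=(4,2^{(n-1)})$: $B$ is a graph $B_3$ with $n$ vertices. 4. $\pi=(3^{(2)},2^{(n-2)})$: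 $B$ is a graph $B_5$ with $n$ vertices. **Theorem.** Let $\pi$ be a bicyclic degree sequence. Then $\pi$ falls under one of the four cases and a graph $B_M(\pi)$ exists. Moreover, every graph $B$ that is a $B_M(\pi)$ is an extremal graph of $\Gamma(\pi)$, that is, $B\in\Gamma(\pi)$ and, for every $f$: if $f$ is escalating, then $M_f(G)\le M_f(B)$ for all $G\in\Gamma(\pi)$; if $f$ is de-escalating, then $M_f(G)\ge M_f(B)$ for all $G\in\Gamma(\pi)$. -/

import Mathlib

universe u

namespace Bicyclic

open Classical in
/-- `G` has `n` vertices, which can be labelled `v₁, …, vₙ` so that `d(vᵢ) = πᵢ`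
(indices start at `0` in the code). -/
def HasDegreeSequence {n : ℕ} {V : Type*} [Fintype V] (π : Fin n → ℕ) (G : SimpleGraph V) :
    Prop :=
  ∃ v : Fin n ≃ V, ∀ i, G.degree (v i) = π i

/-- The class `Γ(π)` of connected graphs with degree sequence `π`. -/
def InGamma {n : ℕ} {V : Type*} [Fintype V] (π : Fin n → ℕ) (G : SimpleGraph V) : Prop :=
  G.Connected ∧ HasDegreeSequence π G

/-- A connected graph with `n` vertices and `n + 1` edges. -/
def IsBicyclic {V : Type*} [Fintype V] (G : SimpleGraph V) : Prop :=
  G.Connected ∧ G.edgeSet.ncard = Fintype.card V + 1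

/-- A non-increasing sequence which is the degree sequence of a bicyclic graph. -/
def IsBicyclicDegreeSequence {n : ℕ} (π : Fin n → ℕ) : Prop :=
  Antitone π ∧ ∃ G : SimpleGraph (Fin n), IsBicyclic G ∧ HasDegreeSequence π G

/-- Symmetric functions of two positive real variables which are escalating. -/
structure IsEscalating (f : ℝ → ℝ → ℝ) : Prop where
  symm : ∀ x y, 0 < x → 0 < y → f x y = f y x
  le : ∀ x₁ y₁ x₂ y₂, 0 < y₁ → y₁ ≤ x₁ → 0 < y₂ → y₂ ≤ x₂ →
    f x₂ y₁ + f x₁ y₂ ≤ f x₁ x₂ + f y₁ y₂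
  lt : ∀ x₁ y₁ x₂ y₂, 0 < y₁ → y₁ < x₁ → 0 < y₂ → y₂ < x₂ →
    f x₂ y₁ + f x₁ y₂ < f x₁ x₂ + f y₁ y₂

/-- Symmetric functions of two positive real variables which are de-escalating. -/
structure IsDeEscalating (f : ℝ → ℝ → ℝ) : Prop where
  symm : ∀ x y, 0 < x → 0 < y → f x y = f y x
  le : ∀ x₁ y₁ x₂ y₂, 0 < y₁ → y₁ ≤ x₁ → 0 < y₂ → y₂ ≤ x₂ →
    f x₁ x₂ + f y₁ y₂ ≤ f x₂ y₁ + f x₁ y₂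
  lt : ∀ x₁ y₁ x₂ y₂, 0 < y₁ → y₁ < x₁ → 0 < y₂ → y₂ < x₂ →
    f x₁ x₂ + f y₁ y₂ < f x₂ y₁ + f x₁ y₂

open Classical in
/-- The connectivity function `M_f(G) = ∑_{uv ∈ E(G)} f(d(u), d(v))`. Each edge is read as a pair
of its end vertices by `Quot.out`; the order does not matter, as `f` is symmetric on positive
numbers and end vertices of edges have positive degree. -/
noncomputable def connectivity {V : Type*} [Fintype V] (f : ℝ → ℝ → ℝ) (G : SimpleGraph V) : ℝ :=
  ∑ e ∈ G.edgeFinset, f (G.degree (Quot.out e).1) (G.degree (Quot.out e).2)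

/-- `B` is an extremal graph of `Γ(π)` with respect to `f`: it lies in `Γ(π)`, it maximizes `M_f`
there if `f` is escalating, and it minimizes `M_f` there if `f` is de-escalating. -/
def IsExtremal {n : ℕ} {V : Type u} [Fintype V] (f : ℝ → ℝ → ℝ) (π : Fin n → ℕ)
    (B : SimpleGraph V) : Prop :=
  InGamma π B ∧
  (IsEscalating f → ∀ (W : Type u) [Fintype W] (G : SimpleGraph W),
    InGamma π G → connectivity f G ≤ connectivity f B) ∧
  (IsDeEscalating f → ∀ (W : Type u) [Fintype W] (G : SimpleGraph W),
    InGamma π G → connectivity f B ≤ connectivity f G)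

open Classical in
/-- `v₁ ≺ v₂ ≺ ⋯ ≺ vₙ` (here `v 0, v 1, …`) is an ordering of the vertices of the connected graph
`G` that makes `G` a BFS-graph; the height of a vertex is its distance to the first vertex. -/
structure IsBFSOrdering {n : ℕ} [NeZero n] {V : Type*} [Fintype V] (G : SimpleGraph V)
    (v : Fin n ≃ V) : Prop where
  connected : G.Connected
  degree_anti : ∀ i j, i ≤ j → G.degree (v j) ≤ G.degree (v i)
  height_mono : ∀ i j, i ≤ j → G.dist (v 0) (v i) ≤ G.dist (v 0) (v j)
  children : ∀ u w x z : Fin n,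
    G.Adj (v u) (v x) → ¬ G.Adj (v w) (v x) → G.Adj (v w) (v z) → ¬ G.Adj (v u) (v z) →
    G.dist (v 0) (v u) = G.dist (v 0) (v w) →
    G.dist (v 0) (v x) = G.dist (v 0) (v u) + 1 →
    G.dist (v 0) (v z) = G.dist (v 0) (v u) + 1 →
    u < w → x < z

/-- One round of deletions: keep the vertices of `S` with at least two neighbours in `S`.
(Isolated vertices are deleted too, so that trees get an empty base graph.) -/
def prune {V : Type*} (G : SimpleGraph V) (S : Set V) : Set V :=
  {x ∈ S | 2 ≤ (G.neighborSet x ∩ S).ncard}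

/-- The vertices of `G` that survive the recursive deletion of pendant vertices. -/
def baseSet {V : Type*} (G : SimpleGraph V) : Set V :=
  ⋂ k : ℕ, (prune G)^[k] Set.univ

/-- The base graph `R(G)`. -/
def baseGraph {V : Type*} (G : SimpleGraph V) : SimpleGraph (baseSet G) :=
  G.induce (baseSet G)

/-- `B₁`: two triangles `012` and `013` sharing the edge `01`, that is, `K₄` minus an edge. -/
def B₁ : SimpleGraph (Fin 4) :=
  SimpleGraph.fromEdgeSet {s(0, 1), s(0, 2), s(1, 2), s(0, 3), s(1, 3)}

/-- `B₂`: two triangles `012` and `034` sharing the vertex `0`. -/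
def B₂ : SimpleGraph (Fin 5) :=
  SimpleGraph.fromEdgeSet {s(0, 1), s(1, 2), s(0, 2), s(0, 3), s(3, 4), s(0, 4)}

/-- `B₃` on `n` vertices: the cycles `0, 1, …, p - 1` and `0, p, …, n - 1`, sharing only the
vertex `0`. It is used for `3 ≤ p` and `p + 2 ≤ n`. -/
def B₃ (n p : ℕ) : SimpleGraph (Fin n) :=
  SimpleGraph.fromRel fun i j =>
    (i.val + 1 = j.val ∧ j.val ≠ p) ∨
    (i.val = 0 ∧ (j.val + 1 = p ∨ j.val = p ∨ j.val + 1 = n))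

/-- `B₅` on `n` vertices: the cycles `0, 1, …, p - 1` and `0, p - 1, p, …, n - 1`, sharing only
the edge joining `0` and `p - 1`. It is used for `3 ≤ p` and `p + 1 ≤ n`. -/
def B₅ (n p : ℕ) : SimpleGraph (Fin n) :=
  SimpleGraph.fromRel fun i j =>
    i.val + 1 = j.val ∨ (i.val = 0 ∧ (j.val + 1 = p ∨ j.val + 1 = n))

/-- The graph obtained from `H` by attaching to its vertex `w` the paths with `l 0, l 1, …`
vertices: an end vertex of each path is joined to `w`. -/
def attachPaths {W : Type*} (H : SimpleGraph W) (w : W) {k : ℕ} (l : Fin k → ℕ) :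
    SimpleGraph (W ⊕ (i : Fin k) × Fin (l i)) :=
  SimpleGraph.fromRel fun a b =>
    match a, b with
    | .inl x, .inl y => H.Adj x y
    | .inl x, .inr ⟨_, s⟩ => x = w ∧ s.val = 0
    | .inr _, .inl _ => False
    | .inr ⟨i, s⟩, .inr ⟨j, t⟩ => i = j ∧ s.val + 1 = t.val

open Classical in
/-- Case `d₁ ≥ d₂ ≥ 3`, `dₙ = 1`: a BFS-graph of degree sequence `π` whose base graph is `B₁`,
located on the first four vertices of the BFS-ordering, `v₁v₂` being the edge shared by the two
triangles; the remaining vertices follow in the BFS-ordering. -/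
def IsBM₁ {n : ℕ} [NeZero n] {V : Type*} [Fintype V] (π : Fin n → ℕ) (B : SimpleGraph V) : Prop :=
  ∃ v : Fin n ≃ V, (∀ i, B.degree (v i) = π i) ∧ IsBFSOrdering B v ∧
    ∃ φ : B₁ ≃g baseGraph B, (φ 0 : V) = v 0 ∧ (φ 1 : V) = v 1 ∧ (φ 2 : V) = v 2 ∧ (φ 3 : V) = v 3

/-- Case `d₁ ≥ 5 > d₂ = 2`, `dₙ = 1`: the graph with `n` vertices obtained from `B₂` by attaching
`d₁ - 4` (non-empty) paths of almost equal lengths to the vertex of degree four. -/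
def IsBM₂ {V : Type*} [Fintype V] (n d₁ : ℕ) (B : SimpleGraph V) : Prop :=
  Fintype.card V = n ∧ ∃ l : Fin (d₁ - 4) → ℕ, (∀ i, 1 ≤ l i) ∧ (∀ i j, l i ≤ l j + 1) ∧
    Nonempty (B ≃g attachPaths B₂ 0 l)

/-- `B` is (isomorphic to) a graph `B_M(π)`, in the four cases of the construction. The indices
`0`, `1`, `⊤` of `Fin n` are those of `d₁`, `d₂`, `dₙ`. -/
def IsBM {n : ℕ} [NeZero n] {V : Type*} [Fintype V] (π : Fin n → ℕ) (B : SimpleGraph V) : Prop :=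
  (π 1 ≤ π 0 ∧ 3 ≤ π 1 ∧ π ⊤ = 1 ∧ IsBM₁ π B) ∨
  (5 ≤ π 0 ∧ π 1 = 2 ∧ π ⊤ = 1 ∧ IsBM₂ n (π 0) B) ∨
  ((∀ i, π i = if i = 0 then 4 else 2) ∧
    ∃ p, 3 ≤ p ∧ p + 2 ≤ n ∧ Nonempty (B ≃g B₃ n p)) ∨
  ((∀ i, π i = if i = 0 ∨ i = 1 then 3 else 2) ∧
    ∃ p, 3 ≤ p ∧ p + 1 ≤ n ∧ Nonempty (B ≃g B₅ n p))

end Bicyclic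

/-!
Let `E(A, B)` be the number of adjacent pairs in `A × B` for vertex sets `A` and `B`, and let `D s`
be the set of vertices of degree at least `s`. Summation by parts in both variables writes
`2 M_f(G)` as a term that depends only on the degree sequence plus the sum over `s`, `t` of
`E(D s, D t)` weighted by the mixed second differences of `f`, which are nonnegative for escalating
`f`. Hence it suffices that `B` maximizes every `E(D s, D t)`.

For `A ⊆ B` in a bicyclic graph there are three upper bounds on `E(A, B)` that depend only on the
sizes and degrees of `A` and `B`: the degree sum of `A`, the number of pairs of distinct vertices,
and, since `k` vertices of a bicyclic graph span at most `k + 1` edges, the mean of the resulting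
bounds for `E(A, A)` and `E(B, B)`. In each of the graphs `B_M(π)` one of them is attained by every
pair `D s ⊆ D t`.
-/

universe v

namespace Bicyclic

open Finset

/-! ### Counting adjacent pairs -/

section Interedges

variable {V : Type*} {G : SimpleGraph V} [DecidableRel G.Adj] {A B C : Finset V}

theorem card_interedges_eq_sum (A B : Finset V) :
    #(G.interedges A B) = ∑ a ∈ A, #{b ∈ B | G.Adj a b} := by
  simp only [SimpleGraph.interedges, Rel.interedges, card_filter, sum_product]

theorem card_interedges_comm (A B : Finset V) :
    #(G.interedges A B) = #(G.interedges B A) :=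
  have : Std.Symm G.Adj := G.symm
  Rel.card_interedges_comm A B

theorem card_interedges_union_right [DecidableEq V] (A : Finset V) (h : Disjoint B C) :
    #(G.interedges A (B ∪ C)) = #(G.interedges A B) + #(G.interedges A C) := by
  simp only [card_interedges_eq_sum, filter_union, ← sum_add_distrib]
  exact sum_congr rfl fun a _ => card_union_of_disjoint (disjoint_filter_filter h)

theorem card_interedges_union_left [DecidableEq V] (h : Disjoint A B) (C : Finset V) :
    #(G.interedges (A ∪ B) C) = #(G.interedges A C) + #(G.interedges B C) := by
  simp only [card_interedges_eq_sum, sum_union h]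

theorem two_mul_card_interedges_le (h : A ⊆ B) :
    2 * #(G.interedges A B) ≤ #(G.interedges A A) + #(G.interedges B B) := by
  classical
  obtain ⟨C, hAC, rfl⟩ : ∃ C, Disjoint A C ∧ B = A ∪ C :=
    ⟨B \ A, disjoint_sdiff, (union_sdiff_of_subset h).symm⟩
  rw [card_interedges_union_left hAC, card_interedges_union_right A hAC,
    card_interedges_union_right C hAC, card_interedges_comm C A]
  omega

theorem card_interedges_le_mul_pred (h : A ⊆ B) : #(G.interedges A B) ≤ #A * (#B - 1) := by
  classical
  rw [card_interedges_eq_sum, ← smul_eq_mul]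
  refine sum_le_card_nsmul _ _ _ fun a ha => ?_
  rw [← card_erase_of_mem (h ha)]
  refine card_le_card fun b hb => ?_
  rw [mem_filter] at hb
  exact mem_erase.2 ⟨hb.2.ne', hb.1⟩

theorem mul_pred_le_card_interedges (h : ∀ a ∈ A, ∀ b ∈ B, a ≠ b → G.Adj a b) :
    #A * (#B - 1) ≤ #(G.interedges A B) := by
  classical
  rw [card_interedges_eq_sum, ← smul_eq_mul]
  refine card_nsmul_le_sum _ _ _ fun a ha =>
    (pred_card_le_card_erase (a := a)).trans (card_le_card fun b hb => ?_)
  rw [mem_erase] at hb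
  exact mem_filter.2 ⟨hb.2, h a ha b hb.2 hb.1.symm⟩

variable [Fintype V]

theorem card_interedges_univ_right (A : Finset V) :
    #(G.interedges A univ) = ∑ a ∈ A, G.degree a := by
  simp only [card_interedges_eq_sum, ← SimpleGraph.card_neighborFinset_eq_degree,
    SimpleGraph.neighborFinset_eq_filter]

theorem card_interedges_univ : #(G.interedges univ univ) = 2 * #G.edgeFinset := by
  rw [card_interedges_univ_right, G.sum_degrees_eq_twice_card_edges]

theorem card_interedges_le_sum_degree : #(G.interedges A B) ≤ ∑ a ∈ A, G.degree a := by
  rw [← card_interedges_univ_right]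
  exact card_le_card (SimpleGraph.interedges_mono G subset_rfl (subset_univ B))

theorem sum_degree_le_card_interedges (h : ∀ a ∈ A, ∀ b, G.Adj a b → b ∈ B) :
    ∑ a ∈ A, G.degree a ≤ #(G.interedges A B) := by
  rw [← card_interedges_univ_right]
  refine card_le_card fun x hx => ?_
  rw [SimpleGraph.mem_interedges_iff] at hx ⊢
  exact ⟨hx.1, h _ hx.1 _ hx.2.2, hx.2.2⟩

theorem sum_interedges_univ_fst {R : Type*} [NonAssocSemiring R] (φ : V → R) :
    ∑ p ∈ G.interedges univ univ, φ p.1 = ∑ u, G.degree u * φ u := by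
  simp only [SimpleGraph.interedges, Rel.interedges, sum_filter, sum_product]
  refine sum_congr rfl fun u _ => ?_
  rw [← sum_filter, sum_const, nsmul_eq_mul, ← SimpleGraph.neighborFinset_eq_filter,
    SimpleGraph.card_neighborFinset_eq_degree]

theorem sum_interedges_univ_snd {R : Type*} [NonAssocSemiring R] (φ : V → R) :
    ∑ p ∈ G.interedges univ univ, φ p.2 = ∑ u, G.degree u * φ u := by
  rw [← sum_interedges_univ_fst]
  refine sum_nbij' Prod.swap Prod.swap ?_ ?_ ?_ ?_ ?_ <;>
    simp [SimpleGraph.mem_interedges_iff, G.adj_comm]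

end Interedges

/-! ### The connectivity function in terms of edge counts -/

section Connectivity

variable {V W : Type*} [Fintype V] [Fintype W] {G : SimpleGraph V} {H : SimpleGraph W}
  [DecidableRel G.Adj] [DecidableRel H.Adj] {f : ℝ → ℝ → ℝ}

/-- The vertices of degree at least `s`. The numbers of edges between these sets determine the
connectivity function, see `two_mul_connectivity_eq`. -/
def degreeAtLeast (G : SimpleGraph V) [DecidableRel G.Adj] (s : ℕ) : Finset V :=
  {v | s ≤ G.degree v}

theorem mem_degreeAtLeast {s : ℕ} {v : V} : v ∈ degreeAtLeast G s ↔ s ≤ G.degree v := by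
  simp [degreeAtLeast]

theorem degreeAtLeast_antitone : Antitone (degreeAtLeast G) := fun s t hst v hv => by
  rw [mem_degreeAtLeast] at hv ⊢
  exact hst.trans hv

theorem degreeAtLeast_eq_univ {s : ℕ} (h : ∀ v, s ≤ G.degree v) : degreeAtLeast G s = univ :=
  eq_univ_iff_forall.2 fun v => mem_degreeAtLeast.2 (h v)

theorem two_mul_connectivity (hf : ∀ x y : ℕ, 0 < x → 0 < y → f x y = f y x) :
    2 * connectivity f G = ∑ p ∈ G.interedges univ univ, f (G.degree p.1) (G.degree p.2) := by
  classical
  have hmaps : ∀ p ∈ G.interedges univ univ, s(p.1, p.2) ∈ G.edgeFinset := fun p hp => by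
    simpa [SimpleGraph.mem_interedges_iff] using hp
  rw [← sum_fiberwise_of_maps_to hmaps, connectivity, mul_sum]
  refine sum_congr (by congr!) fun e he => ?_
  obtain ⟨a, b, hab⟩ : ∃ a b, Quot.out e = (a, b) := ⟨_, _, rfl⟩
  obtain rfl : e = s(a, b) := by rw [← Quot.out_eq e, hab]
  have hadj : G.Adj a b := by simpa using he
  have hfiber : {p ∈ G.interedges univ univ | s(p.1, p.2) = s(a, b)} = {(a, b), (b, a)} := by
    ext ⟨x, y⟩
    simp only [mem_filter, SimpleGraph.mk_mem_interedges_iff, mem_univ, true_and, Sym2.eq_iff,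
      mem_insert, mem_singleton, Prod.mk.injEq, and_iff_right_iff_imp]
    rintro (⟨rfl, rfl⟩ | ⟨rfl, rfl⟩)
    exacts [hadj, hadj.symm]
  have hne : (a, b) ≠ (b, a) := fun h => hadj.ne (Prod.mk.injEq .. ▸ h).1
  have hcomm := hf (G.degree a) (G.degree b) ((G.degree_pos_iff_exists_adj a).2 ⟨b, hadj⟩)
    ((G.degree_pos_iff_exists_adj b).2 ⟨a, hadj.symm⟩)
  rw [hfiber, sum_pair hne, hab, ← hcomm, two_mul]
  congr!

/-- The mixed second difference of `f` at `(s, t)`. -/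
def mixedDiff (f : ℝ → ℝ → ℝ) (s t : ℕ) : ℝ :=
  f (s + 1) (t + 1) - f s (t + 1) - f (s + 1) t + f s t

/-- Symmetry and the non-strict inequalities of `IsEscalating` at the positive integers only. No
other values enter `connectivity f`, since end vertices of edges have positive degree. -/
structure IsEscalatingOnNat (f : ℝ → ℝ → ℝ) : Prop where
  symm : ∀ x y : ℕ, 0 < x → 0 < y → f x y = f y x
  mixedDiff_nonneg : ∀ s t, 0 < s → 0 < t → 0 ≤ mixedDiff f s t

theorem sum_mixedDiff (f : ℝ → ℝ → ℝ) {x y : ℕ} (hx : 1 ≤ x) (hy : 1 ≤ y) :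
    ∑ s ∈ Ico 1 x, ∑ t ∈ Ico 1 y, mixedDiff f s t = f x y - f x 1 - f 1 y + f 1 1 := by
  have inner (s : ℕ) : ∑ t ∈ Ico 1 y, mixedDiff f s t =
      (f ((s + 1 : ℕ) : ℝ) y - f ((s + 1 : ℕ) : ℝ) 1) - (f s y - f s 1) := by
    have := sum_Ico_sub (fun t : ℕ => f (s + 1) t - f s t) hy
    push_cast at this ⊢
    rw [sub_sub_sub_comm, ← this]
    exact sum_congr rfl fun t _ => by rw [mixedDiff]; ring
  have outer := sum_Ico_sub (fun s : ℕ => f s y - f s 1) hx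
  simp only [inner, outer, Nat.cast_one]
  ring

theorem two_mul_connectivity_eq (hf : ∀ x y : ℕ, 0 < x → 0 < y → f x y = f y x) :
    2 * connectivity f G =
      ∑ u, G.degree u * (f (G.degree u) 1 - f 1 1) + ∑ u, G.degree u * f 1 (G.degree u) +
      ∑ q ∈ Ico 1 (Fintype.card V) ×ˢ Ico 1 (Fintype.card V), mixedDiff f q.1 q.2 *
        #(G.interedges (degreeAtLeast G (q.1 + 1)) (degreeAtLeast G (q.2 + 1))) := by
  have layers : ∀ p ∈ G.interedges univ univ, f (G.degree p.1) (G.degree p.2) =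
      (f (G.degree p.1) 1 - f 1 1) + f 1 (G.degree p.2) +
        ∑ q ∈ Ico 1 (G.degree p.1) ×ˢ Ico 1 (G.degree p.2), mixedDiff f q.1 q.2 := fun p hp => by
    have hadj : G.Adj p.1 p.2 := ((SimpleGraph.mem_interedges_iff G).1 hp).2.2
    rw [sum_product, sum_mixedDiff f ((G.degree_pos_iff_exists_adj _).2 ⟨_, hadj⟩)
      ((G.degree_pos_iff_exists_adj _).2 ⟨_, hadj.symm⟩)]
    ring
  rw [two_mul_connectivity hf, sum_congr rfl layers, sum_add_distrib, sum_add_distrib,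
    sum_interedges_univ_fst fun u => f (G.degree u) 1 - f 1 1,
    sum_interedges_univ_snd fun u => f 1 (G.degree u)]
  congr 1
  simp only [← nsmul_eq_mul', ← sum_const]
  refine sum_comm' fun p q => ?_
  have := G.degree_lt_card_verts p.1
  have := G.degree_lt_card_verts p.2
  simp only [SimpleGraph.mem_interedges_iff, mem_degreeAtLeast, mem_product, mem_Ico, mem_univ]
  grind

end Connectivity

/-! ### Degree sequences -/

section DegreeSequence

variable {n : ℕ} {π : Fin n → ℕ} {V W : Type*} [Fintype V] [Fintype W] {G : SimpleGraph V}
  {H : SimpleGraph W}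

theorem hasDegreeSequence_iff [DecidableRel G.Adj] :
    HasDegreeSequence π G ↔ ∃ v : Fin n ≃ V, ∀ i, G.degree (v i) = π i := by
  rw [HasDegreeSequence]
  congr!

theorem HasDegreeSequence.card_eq (h : HasDegreeSequence π G) : Fintype.card V = n := by
  obtain ⟨v, -⟩ := h
  rw [← Fintype.card_congr v, Fintype.card_fin]

theorem HasDegreeSequence.of_iso (h : HasDegreeSequence π G) (e : G ≃g H) :
    HasDegreeSequence π H := by
  classical
  obtain ⟨v, hv⟩ := h
  exact ⟨v.trans e.toEquiv, fun i => (e.degree_eq (v i)).trans (hv i)⟩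

theorem InGamma.of_iso (h : InGamma π G) (e : G ≃g H) : InGamma π H :=
  ⟨e.connected_iff.1 h.1, h.2.of_iso e⟩

variable [DecidableRel G.Adj] [DecidableRel H.Adj]

theorem HasDegreeSequence.sum_degree {M : Type*} [AddCommMonoid M] (h : HasDegreeSequence π G)
    (φ : ℕ → M) : ∑ v, φ (G.degree v) = ∑ i, φ (π i) := by
  obtain ⟨v, hv⟩ := hasDegreeSequence_iff.1 h
  simp only [← v.sum_comp, hv]

theorem HasDegreeSequence.card_interedges_univ (h : HasDegreeSequence π G) :
    #(G.interedges univ univ) = ∑ i, π i := by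
  rw [card_interedges_univ_right]
  exact h.sum_degree id

theorem HasDegreeSequence.card_degreeAtLeast (h : HasDegreeSequence π G) (s : ℕ) :
    #(degreeAtLeast G s) = #{i | s ≤ π i} := by
  rw [degreeAtLeast, card_filter, card_filter]
  exact h.sum_degree fun d => if s ≤ d then 1 else 0

theorem HasDegreeSequence.sum_degree_degreeAtLeast (h : HasDegreeSequence π G) (s : ℕ) :
    ∑ v ∈ degreeAtLeast G s, G.degree v = ∑ i with s ≤ π i, π i := by
  rw [degreeAtLeast, sum_filter, sum_filter]
  exact h.sum_degree fun d => if s ≤ d then d else 0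

theorem connectivity_le {f : ℝ → ℝ → ℝ} (hf : IsEscalatingOnNat f)
    (hG : HasDegreeSequence π G) (hH : HasDegreeSequence π H)
    (hle : ∀ s t, t ≤ s → #(G.interedges (degreeAtLeast G s) (degreeAtLeast G t)) ≤
      #(H.interedges (degreeAtLeast H s) (degreeAtLeast H t))) :
    connectivity f G ≤ connectivity f H := by
  suffices 2 * connectivity f G ≤ 2 * connectivity f H by linarith
  rw [two_mul_connectivity_eq hf.symm, two_mul_connectivity_eq hf.symm,
    hG.sum_degree fun d => (d : ℝ) * (f d 1 - f 1 1), hG.sum_degree fun d => (d : ℝ) * f 1 d,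
    hH.sum_degree fun d => (d : ℝ) * (f d 1 - f 1 1), hH.sum_degree fun d => (d : ℝ) * f 1 d,
    hG.card_eq, hH.card_eq]
  gcongr with q hq
  · simp only [mem_product, mem_Ico] at hq
    exact hf.mixedDiff_nonneg _ _ (by omega) (by omega)
  · rcases le_total q.2 q.1 with h | h
    · exact hle _ _ (by omega)
    · rw [card_interedges_comm, card_interedges_comm (G := H)]
      exact hle _ _ (by omega)

end DegreeSequence

theorem connectivity_neg {V : Type*} [Fintype V] (f : ℝ → ℝ → ℝ) (G : SimpleGraph V) :
    connectivity (-f) G = -connectivity f G := by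
  simp [connectivity]

theorem IsEscalating.isEscalatingOnNat {f : ℝ → ℝ → ℝ} (hf : IsEscalating f) :
    IsEscalatingOnNat f where
  symm x y hx hy := hf.symm x y (mod_cast hx) (mod_cast hy)
  mixedDiff_nonneg s t hs ht := by
    have hle := hf.le (s + 1) s (t + 1) t (by positivity) (by linarith) (by positivity)
      (by linarith)
    rw [hf.symm (t + 1) s (by positivity) (by positivity)] at hle
    rw [mixedDiff]
    linarith

theorem IsDeEscalating.neg {f : ℝ → ℝ → ℝ} (hf : IsDeEscalating f) : IsEscalating (-f) where
  symm x y hx hy := congrArg Neg.neg (hf.symm x y hx hy)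
  le x₁ y₁ x₂ y₂ hy₁ hx₁ hy₂ hx₂ := by
    simpa only [Pi.neg_apply, ← neg_add, neg_le_neg_iff] using hf.le x₁ y₁ x₂ y₂ hy₁ hx₁ hy₂ hx₂
  lt x₁ y₁ x₂ y₂ hy₁ hx₁ hy₂ hx₂ := by
    simpa only [Pi.neg_apply, ← neg_add, neg_lt_neg_iff] using hf.lt x₁ y₁ x₂ y₂ hy₁ hx₁ hy₂ hx₂

/-! ### Edge counts in bicyclic graphs -/

theorem card_interedges_self_add_two_le {V : Type*} [DecidableEq V] {G : SimpleGraph V}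
    [DecidableRel G.Adj] {A : Finset V} {a x : V} (ha : a ∈ A) (hx : x ∉ A) (hax : G.Adj a x) :
    #(G.interedges A A) + 2 ≤ #(G.interedges (insert x A) (insert x A)) := by
  have hdisj : Disjoint {x} A := disjoint_singleton_left.2 hx
  have hpos : 0 < #(G.interedges {x} A) := card_pos.2
    ⟨(x, a), (G.mk_mem_interedges_iff).2 ⟨mem_singleton_self x, ha, hax.symm⟩⟩
  rw [insert_eq, card_interedges_union_left hdisj, card_interedges_union_right _ hdisj,
    card_interedges_union_right _ hdisj, card_interedges_comm A {x}]
  omega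

section BicyclicGraph

variable {V W : Type*} [Fintype V] [Fintype W] {G : SimpleGraph V} {H : SimpleGraph W}
  [DecidableRel G.Adj] [DecidableRel H.Adj]

theorem isBicyclic_iff :
    IsBicyclic G ↔ G.Connected ∧ #(G.interedges univ univ) = 2 * (Fintype.card V + 1) := by
  rw [IsBicyclic, card_interedges_univ, ← SimpleGraph.coe_edgeFinset, Set.ncard_coe_finset,
    Nat.mul_right_inj two_ne_zero]

-- Each vertex joined to a growing vertex set brings at least one new edge.
theorem card_interedges_self_add_le_of_connected (hG : G.Connected) {A : Finset V}
    (hA : A.Nonempty) :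
    #(G.interedges A A) + 2 * Fintype.card V ≤ #(G.interedges univ univ) + 2 * #A := by
  classical
  induction A using WellFoundedGT.induction with
  | ind A ih =>
    rcases eq_or_ne A univ with rfl | hne
    · rfl
    obtain ⟨y, hy⟩ : ∃ y, y ∉ A := by simpa [eq_univ_iff_forall] using hne
    obtain ⟨a, ha⟩ := hA
    obtain ⟨p⟩ := hG.preconnected a y
    obtain ⟨d, -, hfst, hsnd⟩ := p.exists_boundary_dart (A : Set V) ha hy
    have hstep := card_interedges_self_add_two_le hfst hsnd d.adj
    have hcard := card_insert_of_notMem hsnd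
    have hrec := ih _ (ssubset_insert hsnd) (insert_nonempty _ _)
    omega

/-- The largest number of edges that `p` vertices of a bicyclic graph can span. -/
def maxEdges (p : ℕ) : ℕ := min (p.choose 2) (p + 1)

theorem IsBicyclic.card_interedges_self_le (hG : IsBicyclic G) (A : Finset V) :
    #(G.interedges A A) ≤ 2 * maxEdges #A := by
  have hchoose : 2 * (#A).choose 2 = #A * (#A - 1) := by
    rw [Nat.choose_two_right, Nat.mul_div_cancel' (Nat.even_mul_pred_self _).two_dvd]
  have hpairs := card_interedges_le_mul_pred (G := G) (subset_refl A)
  rcases A.eq_empty_or_nonempty with rfl | hA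
  · simp [SimpleGraph.interedges]
  · have hconn := card_interedges_self_add_le_of_connected hG.1 hA
    have huniv := (isBicyclic_iff.1 hG).2
    rw [maxEdges]
    omega

/-- The number of edges between `A` and `B` attains one of three upper bounds, which hold for
`A ⊆ B` in every bicyclic graph and depend only on the degrees of the vertices in `A` and on the
sizes of `A` and `B`. -/
def AttainsEdgeBound (G : SimpleGraph V) [DecidableRel G.Adj] (A B : Finset V) : Prop :=
  ∑ a ∈ A, G.degree a ≤ #(G.interedges A B) ∨
  #A * (#B - 1) ≤ #(G.interedges A B) ∨
  maxEdges #A + maxEdges #B ≤ #(G.interedges A B)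

/-- The bounds of `AttainsEdgeBound` are attained between any two sets of vertices of large
degree. Among the bicyclic graphs with a given degree sequence, such a graph is extremal. -/
def AttainsEdgeBounds (G : SimpleGraph V) [DecidableRel G.Adj] : Prop :=
  ∀ s t, t ≤ s → AttainsEdgeBound G (degreeAtLeast G s) (degreeAtLeast G t)

theorem IsBicyclic.card_interedges_le (hG : IsBicyclic G) {A B : Finset V} (hAB : A ⊆ B)
    {C D : Finset W} (hAC : #A = #C) (hBD : #B = #D)
    (hdeg : ∑ a ∈ A, G.degree a = ∑ c ∈ C, H.degree c) (hH : AttainsEdgeBound H C D) :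
    #(G.interedges A B) ≤ #(H.interedges C D) := by
  rw [AttainsEdgeBound, ← hAC, ← hBD, ← hdeg] at hH
  rcases hH with h | h | h
  · exact card_interedges_le_sum_degree.trans h
  · exact (card_interedges_le_mul_pred hAB).trans h
  · have hA := hG.card_interedges_self_le A
    have hB := hG.card_interedges_self_le B
    have := two_mul_card_interedges_le (G := G) hAB
    omega

theorem AttainsEdgeBounds.of_iso (h : AttainsEdgeBounds G) (e : G ≃g H) :
    AttainsEdgeBounds H := by
  have hmap (s : ℕ) : degreeAtLeast H s = (degreeAtLeast G s).map e.toEquiv.toEmbedding := by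
    ext v
    obtain ⟨u, rfl⟩ := e.surjective v
    rw [mem_degreeAtLeast, e.degree_eq, ← mem_degreeAtLeast]
    exact (mem_map' e.toEquiv.toEmbedding).symm
  intro s t hst
  have hE (A B : Finset V) : #(H.interedges (A.map e.toEquiv.toEmbedding)
      (B.map e.toEquiv.toEmbedding)) = #(G.interedges A B) := by
    simp [card_interedges_eq_sum, sum_map, filter_map, e.map_adj_iff]
  simpa [AttainsEdgeBound, hmap, hE] using h s t hst

theorem card_interedges_univ_add_le :
    #(G.interedges univ univ) + 2 * #(degreeAtLeast G 2) ≤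
      #(G.interedges (degreeAtLeast G 2) (degreeAtLeast G 2)) + 2 * Fintype.card V := by
  classical
  set A := degreeAtLeast G 2 with hA
  have hdisj : Disjoint A Aᶜ := disjoint_compl_right
  have hleaves : #(G.interedges Aᶜ univ) ≤ #Aᶜ := by
    rw [card_interedges_univ_right, card_eq_sum_ones]
    refine sum_le_sum fun v hv => ?_
    rw [mem_compl, hA, mem_degreeAtLeast] at hv
    omega
  have hsplit : #(G.interedges univ univ) =
      #(G.interedges A A) + #(G.interedges Aᶜ A) + #(G.interedges Aᶜ univ) := by
    rw [card_interedges_comm Aᶜ A, ← card_interedges_union_right A hdisj, union_compl,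
      ← card_interedges_union_left hdisj, union_compl]
  have hle : #(G.interedges Aᶜ A) ≤ #(G.interedges Aᶜ univ) :=
    card_le_card (SimpleGraph.interedges_mono G subset_rfl (subset_univ A))
  have := card_add_card_compl A
  omega

end BicyclicGraph

/-! ### Bicyclic degree sequences -/

namespace IsBicyclicDegreeSequence

variable {n : ℕ} {π : Fin n → ℕ}

theorem sum_eq (h : IsBicyclicDegreeSequence π) : ∑ i, π i = 2 * (n + 1) := by
  classical
  obtain ⟨-, G, hG, hdeg⟩ := h
  rw [← hdeg.card_interedges_univ, (isBicyclic_iff.1 hG).2, Fintype.card_fin]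

theorem isBicyclic (h : IsBicyclicDegreeSequence π) {V : Type*} [Fintype V] {G : SimpleGraph V}
    (hG : InGamma π G) : IsBicyclic G := by
  classical
  rw [isBicyclic_iff, hG.2.card_interedges_univ, h.sum_eq, hG.2.card_eq]
  exact ⟨hG.1, rfl⟩

theorem four_le_card (h : IsBicyclicDegreeSequence π) : 4 ≤ #{i | 2 ≤ π i} := by
  classical
  obtain ⟨-, G, hG, hdeg⟩ := h
  have huniv := (isBicyclic_iff.1 hG).2
  have hprune := card_interedges_univ_add_le (G := G)
  have hpairs := card_interedges_le_mul_pred (G := G) (subset_refl (degreeAtLeast G 2))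
  rw [← hdeg.card_degreeAtLeast]
  by_contra! hlt
  interval_cases #(degreeAtLeast G 2) <;> omega

theorem four_le (h : IsBicyclicDegreeSequence π) : 4 ≤ n := by
  simpa using h.four_le_card.trans (card_le_univ _)

theorem val_one [NeZero n] (h : IsBicyclicDegreeSequence π) : (1 : Fin n).val = 1 := by
  have := h.four_le
  rw [Fin.val_one', Nat.mod_eq_of_lt (by omega)]

theorem pos (h : IsBicyclicDegreeSequence π) (i : Fin n) : 1 ≤ π i := by
  classical
  have hn := h.four_le
  obtain ⟨-, G, hG, v, hv⟩ := h
  have : Nontrivial (Fin n) := Fin.nontrivial_iff_two_le.2 (by omega)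
  rw [← hv]
  exact hG.1.preconnected.degree_pos_of_nontrivial _

theorem lt_card (h : IsBicyclicDegreeSequence π) (i : Fin n) : π i < n := by
  classical
  obtain ⟨-, G, -, v, hv⟩ := h
  simpa [hv] using G.degree_lt_card_verts (v i)

theorem two_le (h : IsBicyclicDegreeSequence π) {i : Fin n} (hi : i.val < 4) : 2 ≤ π i := by
  by_contra! hlt
  have hsub : ({j | 2 ≤ π j} : Finset (Fin n)) ⊆ Iio i := fun j hj => by
    rw [mem_filter] at hj
    exact mem_Iio.2 (h.1.reflect_lt (hlt.trans_le hj.2))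
  have := h.four_le_card.trans (card_le_card hsub)
  rw [Fin.card_Iio] at this
  omega

variable [NeZero n]

theorem le_apply_one (h : IsBicyclicDegreeSequence π) {i : Fin n} (hi : i ≠ 0) : π i ≤ π 1 := by
  refine h.1 (Fin.le_def.2 ?_)
  rw [h.val_one, Nat.one_le_iff_ne_zero]
  exact Fin.val_ne_zero_iff.2 hi

theorem five_le_apply_zero (h : IsBicyclicDegreeSequence π) (h1 : π 1 = 2) (htop : π ⊤ = 1) :
    5 ≤ π 0 := by
  have hn := h.four_le
  have htop_ne : (⊤ : Fin n) ≠ 0 := fun e => by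
    have := h.two_le (i := 0) (by simp)
    rw [e] at htop
    omega
  have hlt : ∑ i ∈ univ.erase 0, π i < ∑ i ∈ (univ : Finset (Fin n)).erase 0, 2 :=
    sum_lt_sum (fun i hi => (h.le_apply_one (ne_of_mem_erase hi)).trans h1.le)
      ⟨⊤, mem_erase.2 ⟨htop_ne, mem_univ _⟩, by omega⟩
  have hsum := h.sum_eq
  rw [← add_sum_erase _ _ (mem_univ (0 : Fin n))] at hsum
  rw [sum_const, card_erase_of_mem (mem_univ _), card_fin, smul_eq_mul] at hlt
  omega

theorem eq_ite_or_eq_ite (h : IsBicyclicDegreeSequence π) (h2 : ∀ i, 2 ≤ π i) :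
    (∀ i, π i = if i = 0 then 4 else 2) ∨ (∀ i, π i = if i = 0 ∨ i = 1 then 3 else 2) := by
  have hexcess : ∑ i, (π i - 2) = 2 := by
    rw [sum_tsub_distrib _ fun i _ => h2 i, h.sum_eq, sum_const, card_fin, smul_eq_mul]
    omega
  have hpartial (S : Finset (Fin n)) : ∑ i ∈ S, (π i - 2) ≤ 2 :=
    (sum_le_sum_of_subset (subset_univ S)).trans hexcess.le
  have h01 : (0 : Fin n) ≠ 1 := Fin.ne_of_val_ne (by rw [h.val_one]; exact zero_ne_one)
  have h10 : π 1 ≤ π 0 := h.1 (Fin.zero_le _)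
  by_cases h3 : 3 ≤ π 1
  · refine Or.inr fun i => ?_
    have hpair := hpartial {0, 1}
    rw [sum_pair h01] at hpair
    split_ifs with hi
    · rcases hi with rfl | rfl <;> omega
    · have htriple := hpartial (insert i {0, 1})
      rw [sum_insert (by simpa using hi), sum_pair h01] at htriple
      have := h2 i
      omega
  · have hrest (i : Fin n) (hi : i ≠ 0) : π i = 2 := by
      have := h.le_apply_one hi
      have := h2 i
      omega
    rw [sum_eq_single 0 (fun i _ hi => by simp [hrest i hi]) (by simp)] at hexcess
    refine Or.inl fun i => ?_
    split_ifs with hi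
    · subst hi
      omega
    · exact hrest i hi

theorem cases (h : IsBicyclicDegreeSequence π) :
    (3 ≤ π 1 ∧ π ⊤ = 1) ∨ (5 ≤ π 0 ∧ π 1 = 2 ∧ π ⊤ = 1) ∨
    (∀ i, π i = if i = 0 then 4 else 2) ∨ (∀ i, π i = if i = 0 ∨ i = 1 then 3 else 2) := by
  have hone : 2 ≤ π 1 := h.two_le (by rw [h.val_one]; norm_num)
  have htop := h.pos ⊤
  rcases htop.eq_or_lt with htop | htop
  · rcases hone.eq_or_lt with hone | hone
    · exact Or.inr (Or.inl ⟨h.five_le_apply_zero hone.symm htop.symm, hone.symm, htop.symm⟩)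
    · exact Or.inl ⟨hone, htop.symm⟩
  · exact Or.inr (Or.inr (h.eq_ite_or_eq_ite fun i => htop.trans_le (h.1 le_top)))

end IsBicyclicDegreeSequence

/-! ### Bicyclic graphs without pendant vertices -/

theorem attainsEdgeBounds_of_isClique {V : Type*} [Fintype V] {G : SimpleGraph V}
    [DecidableRel G.Adj] (hdeg : ∀ v, 2 ≤ G.degree v) (hclique : G.IsClique {v | 3 ≤ G.degree v}) :
    AttainsEdgeBounds G := by
  intro s t hst
  rcases le_or_gt t 2 with ht | ht
  · rw [degreeAtLeast_eq_univ fun v => ht.trans (hdeg v)]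
    exact Or.inl (card_interedges_univ_right _).ge
  · refine Or.inr (Or.inl (mul_pred_le_card_interedges fun a ha b hb hab => ?_))
    rw [mem_degreeAtLeast] at ha hb
    exact hclique (ht.trans_le (hst.trans ha)) (ht.trans_le hb) hab

theorem connected_of_forall_ne_exists_adj_lt {V : Type*} [Preorder V] [WellFoundedLT V]
    {G : SimpleGraph V} (r : V) (h : ∀ v ≠ r, ∃ u < v, G.Adj u v) : G.Connected := by
  refine (SimpleGraph.connected_iff_exists_forall_reachable G).2 ⟨r, fun v => ?_⟩
  induction v using WellFoundedLT.induction with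
  | ind v ih =>
    rcases eq_or_ne v r with rfl | hv
    · rfl
    · obtain ⟨u, huv, hadj⟩ := h v hv
      exact (ih u huv).trans hadj.reachable

section Fin

variable {n p : ℕ}

theorem degree_eq_card_of_adj_iff {G : SimpleGraph (Fin n)} [DecidableRel G.Adj] {i : Fin n}
    (S : Finset ℕ) (hS : ∀ j ∈ S, j < n) (h : ∀ j, G.Adj i j ↔ j.val ∈ S) : G.degree i = #S := by
  rw [← SimpleGraph.card_neighborFinset_eq_degree, ← card_map Fin.valEmbedding]
  congr 1
  ext j
  simp only [mem_map, SimpleGraph.mem_neighborFinset, h, Fin.valEmbedding_apply]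
  exact ⟨fun ⟨_, hi, hij⟩ => hij ▸ hi, fun hj => ⟨⟨j, hS j hj⟩, hj, rfl⟩⟩

theorem connected_B₃ [NeZero n] (hp : 3 ≤ p) : (B₃ n p).Connected := by
  refine connected_of_forall_ne_exists_adj_lt 0 fun j hj => ?_
  rw [← Fin.val_ne_zero_iff] at hj
  by_cases hjp : j.val = p
  · refine ⟨⟨0, by omega⟩, Fin.lt_def.2 (by dsimp only; omega), ?_⟩
    simp only [B₃, SimpleGraph.fromRel_adj, ne_eq, Fin.ext_iff, true_and]
    omega
  · refine ⟨⟨j.val - 1, by omega⟩, Fin.lt_def.2 (by dsimp only; omega), ?_⟩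
    simp only [B₃, SimpleGraph.fromRel_adj, ne_eq, Fin.ext_iff]
    omega

theorem connected_B₅ [NeZero n] (p : ℕ) : (B₅ n p).Connected := by
  refine connected_of_forall_ne_exists_adj_lt 0 fun j hj => ?_
  rw [← Fin.val_ne_zero_iff] at hj
  refine ⟨⟨j.val - 1, by omega⟩, Fin.lt_def.2 (by dsimp only; omega), ?_⟩
  simp only [B₅, SimpleGraph.fromRel_adj, ne_eq, Fin.ext_iff]
  omega

theorem degree_B₃ [DecidableRel (B₃ n p).Adj] (hp : 3 ≤ p) (hpn : p + 2 ≤ n) (i : Fin n) :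
    (B₃ n p).degree i = if i.val = 0 then 4 else 2 := by
  split_ifs with hi
  · rw [degree_eq_card_of_adj_iff {1, p - 1, p, n - 1}]
    · repeat rw [card_insert_of_notMem (by simp only [mem_insert, mem_singleton]; omega)]
      rw [card_singleton]
    · simp only [mem_insert, mem_singleton]
      omega
    · intro j
      simp only [B₃, SimpleGraph.fromRel_adj, ne_eq, Fin.ext_iff, mem_insert, mem_singleton]
      omega
  · rw [degree_eq_card_of_adj_iff {if i.val = p then 0 else i.val - 1,
      if i.val + 1 = p ∨ i.val + 1 = n then 0 else i.val + 1}]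
    · rw [card_pair]
      split_ifs <;> omega
    · simp only [mem_insert, mem_singleton]
      grind
    · intro j
      simp only [B₃, SimpleGraph.fromRel_adj, ne_eq, Fin.ext_iff, mem_insert, mem_singleton]
      split_ifs <;> omega

theorem degree_B₅ [DecidableRel (B₅ n p).Adj] (hp : 3 ≤ p) (hpn : p + 1 ≤ n) (i : Fin n) :
    (B₅ n p).degree i = if i.val = 0 ∨ i.val + 1 = p then 3 else 2 := by
  split_ifs with hi
  · rw [degree_eq_card_of_adj_iff (if i.val = 0 then {1, p - 1, n - 1} else {0, p - 2, p})]
    · split_ifs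
      all_goals
        repeat rw [card_insert_of_notMem (by simp only [mem_insert, mem_singleton]; omega)]
        rw [card_singleton]
    · grind
    · intro j
      simp only [B₅, SimpleGraph.fromRel_adj, ne_eq, Fin.ext_iff]
      split_ifs <;> simp only [mem_insert, mem_singleton] <;> omega
  · rw [degree_eq_card_of_adj_iff {i.val - 1, if i.val + 1 = n then 0 else i.val + 1}]
    · rw [card_pair]
      split_ifs <;> omega
    · grind
    · intro j
      simp only [B₅, SimpleGraph.fromRel_adj, ne_eq, Fin.ext_iff, mem_insert, mem_singleton]
      split_ifs <;> omega

theorem attainsEdgeBounds_B₃ [DecidableRel (B₃ n p).Adj] (hp : 3 ≤ p) (hpn : p + 2 ≤ n) :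
    AttainsEdgeBounds (B₃ n p) := by
  refine attainsEdgeBounds_of_isClique (fun i => ?_) fun i hi j hj hij => ?_
  · rw [degree_B₃ hp hpn]
    split_ifs <;> norm_num
  · simp only [Set.mem_ofPred_eq, degree_B₃ hp hpn] at hi hj
    grind

theorem attainsEdgeBounds_B₅ [DecidableRel (B₅ n p).Adj] (hp : 3 ≤ p) (hpn : p + 1 ≤ n) :
    AttainsEdgeBounds (B₅ n p) := by
  refine attainsEdgeBounds_of_isClique (fun i => ?_) fun i hi j hj hij => ?_
  · rw [degree_B₅ hp hpn]
    split_ifs <;> norm_num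
  · simp only [Set.mem_ofPred_eq, degree_B₅ hp hpn] at hi hj
    simp only [B₅, SimpleGraph.fromRel_adj, ne_eq, Fin.ext_iff]
    grind

variable [NeZero n] {π : Fin n → ℕ}

theorem inGamma_B₃ (hπ : ∀ i, π i = if i = 0 then 4 else 2) (hp : 3 ≤ p) (hpn : p + 2 ≤ n) :
    InGamma π (B₃ n p) := by
  classical
  refine ⟨connected_B₃ hp, hasDegreeSequence_iff.2 ⟨Equiv.refl _, fun i => ?_⟩⟩
  rw [Equiv.refl_apply, degree_B₃ hp hpn, hπ]
  simp only [Fin.val_eq_zero_iff]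

theorem inGamma_B₅ (hπ : ∀ i, π i = if i = 0 ∨ i = 1 then 3 else 2) (hp : 3 ≤ p)
    (hpn : p + 1 ≤ n) : InGamma π (B₅ n p) := by
  classical
  have hval : (1 : Fin n).val = 1 := Nat.mod_eq_of_lt (show 1 < n by omega)
  refine ⟨connected_B₅ p, hasDegreeSequence_iff.2
    ⟨Equiv.swap 1 ⟨p - 1, by omega⟩, fun i => ?_⟩⟩
  rw [degree_B₅ hp hpn, hπ, Equiv.swap_apply_def]
  simp only [Fin.ext_iff, hval, Fin.val_zero]
  grind

end Fin

/-! ### Attaching paths to a vertex -/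

section attachPaths

variable {W : Type*} {H : SimpleGraph W} {w : W} {k : ℕ} {l : Fin k → ℕ}

theorem attachPaths_adj_inl_inl {x y : W} :
    (attachPaths H w l).Adj (.inl x) (.inl y) ↔ H.Adj x y := by
  simp only [attachPaths, SimpleGraph.fromRel_adj, ne_eq, Sum.inl.injEq]
  exact ⟨fun h => h.2.elim id SimpleGraph.Adj.symm, fun h => ⟨h.ne, Or.inl h⟩⟩

theorem attachPaths_adj_inl_inr {x : W} {i : Fin k} {s : Fin (l i)} :
    (attachPaths H w l).Adj (.inl x) (.inr ⟨i, s⟩) ↔ x = w ∧ s.val = 0 := by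
  simp [attachPaths, SimpleGraph.fromRel_adj]

theorem attachPaths_adj_inr_inl {x : W} {i : Fin k} {s : Fin (l i)} :
    (attachPaths H w l).Adj (.inr ⟨i, s⟩) (.inl x) ↔ x = w ∧ s.val = 0 := by
  rw [SimpleGraph.adj_comm, attachPaths_adj_inl_inr]

theorem attachPaths_adj_inr_inr {i j : Fin k} {s : Fin (l i)} {t : Fin (l j)} :
    (attachPaths H w l).Adj (.inr ⟨i, s⟩) (.inr ⟨j, t⟩) ↔
      i = j ∧ (t.val = s.val + 1 ∨ s.val = t.val + 1) := by
  simp only [attachPaths, SimpleGraph.fromRel_adj, ne_eq, Sum.inr.injEq, Sigma.mk.injEq]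
  grind

theorem connected_attachPaths (hH : H.Connected) : (attachPaths H w l).Connected := by
  refine (SimpleGraph.connected_iff_exists_forall_reachable _).2 ⟨.inl w, ?_⟩
  rintro (x | ⟨i, s, hs⟩)
  · exact (hH.preconnected w x).map ⟨Sum.inl, attachPaths_adj_inl_inl.2⟩
  · induction s with
    | zero => exact (attachPaths_adj_inl_inr.2 ⟨rfl, rfl⟩).reachable
    | succ s ih =>
      exact (ih (by omega)).trans (attachPaths_adj_inr_inr.2 ⟨rfl, Or.inl rfl⟩).reachable

theorem degree_sum_sigma {α ι : Type*} {β : ι → Type*} [Fintype α] [Fintype ι]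
    [∀ i, Fintype (β i)] (G : SimpleGraph (α ⊕ (i : ι) × β i)) [DecidableRel G.Adj]
    (v : α ⊕ (i : ι) × β i) :
    G.degree v = #{x | G.Adj v (.inl x)} + ∑ i, #{s | G.Adj v (.inr ⟨i, s⟩)} := by
  rw [← G.card_neighborFinset_eq_degree, G.neighborFinset_eq_filter]
  simp only [card_filter, Fintype.sum_sum_type, Fintype.sum_sigma]

theorem card_filter_val_eq (m a : ℕ) : #{t : Fin m | t.val = a} = if a < m then 1 else 0 := by
  split_ifs with ha
  · exact card_eq_one.2 ⟨⟨a, ha⟩, by simp [Finset.ext_iff, Fin.ext_iff]⟩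
  · exact card_eq_zero.2 (filter_eq_empty_iff.2 fun t _ ht => ha (ht ▸ t.2))

theorem degree_attachPaths_inr [Fintype W] [DecidableRel (attachPaths H w l).Adj] (i : Fin k)
    (s : Fin (l i)) :
    (attachPaths H w l).degree (.inr ⟨i, s⟩) = if s.val + 1 < l i then 2 else 1 := by
  classical
  have hpath : ∑ j, #{t : Fin (l j) | i = j ∧ (t.val = s.val + 1 ∨ s.val = t.val + 1)} =
      #{t : Fin (l i) | t.val = s.val + 1} + #{t : Fin (l i) | s.val = t.val + 1} := by
    rw [sum_eq_single i (fun j _ hj => by simp [hj.symm]) (by simp),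
      ← card_union_of_disjoint (disjoint_filter.2 fun t _ h₁ h₂ => by omega), ← filter_or]
    simp
  rw [degree_sum_sigma]
  simp only [attachPaths_adj_inr_inl, attachPaths_adj_inr_inr, hpath, card_filter_val_eq]
  have hw : #{x | x = w} = 1 := card_eq_one.2 ⟨w, by simp [Finset.ext_iff]⟩
  rcases hs : s.val with _ | r
  · simp only [and_true, hw, zero_add, Nat.add_eq_zero_iff, one_ne_zero, and_false,
      eq_comm (a := 0), filter_false, card_empty]
    split_ifs <;> rfl
  · have hr : r < l i := by omega
    simp only [Nat.add_right_cancel_iff, eq_comm (a := r), card_filter_val_eq, hr, if_true,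
      Nat.add_eq_zero_iff, one_ne_zero, and_false, filter_false, card_empty]
    split_ifs <;> rfl

theorem degree_attachPaths_inl [Fintype W] [DecidableEq W] [DecidableRel H.Adj]
    [DecidableRel (attachPaths H w l).Adj] (hl : ∀ i, 1 ≤ l i) (x : W) :
    (attachPaths H w l).degree (.inl x) = H.degree x + if x = w then k else 0 := by
  have hpath (i : Fin k) : #{s : Fin (l i) | x = w ∧ s.val = 0} = if x = w then 1 else 0 := by
    split_ifs with hx
    · simpa [hx, Nat.one_le_iff_ne_zero.1 (hl i), Nat.pos_iff_ne_zero] using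
        card_filter_val_eq (l i) 0
    · simp [hx]
  simp only [degree_sum_sigma, attachPaths_adj_inl_inl, attachPaths_adj_inl_inr, hpath]
  rw [← H.card_neighborFinset_eq_degree, H.neighborFinset_eq_filter]
  simp

theorem isBicyclic_attachPaths [Fintype W] (hl : ∀ i, 1 ≤ l i) (hH : IsBicyclic H) :
    IsBicyclic (attachPaths H w l) := by
  classical
  have hpath (i : Fin k) : ∑ s : Fin (l i), (if s.val + 1 < l i then 2 else 1) + 1 = 2 * l i := by
    obtain ⟨m, hm⟩ := Nat.exists_eq_add_of_le' (hl i)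
    rw [hm, Fin.sum_univ_castSucc]
    simp only [Fin.val_castSucc, Fin.val_last, add_lt_add_iff_right, Fin.is_lt, if_true, sum_const,
      card_univ, Fintype.card_fin, lt_irrefl, if_false, smul_eq_mul]
    omega
  have hpaths := sum_congr (rfl : (univ : Finset (Fin k)) = univ) fun i _ => hpath i
  rw [isBicyclic_iff] at hH ⊢
  refine ⟨connected_attachPaths hH.1, ?_⟩
  rw [card_interedges_univ_right] at hH ⊢
  simp only [Fintype.sum_sum_type, Fintype.sum_sigma, degree_attachPaths_inl hl,
    degree_attachPaths_inr, sum_add_distrib, hH.2, sum_ite_eq', mem_univ, if_true,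
    Fintype.card_sum, Fintype.card_sigma, Fintype.card_fin, ← mul_sum, sum_const, card_univ,
    smul_eq_mul, mul_one] at hpaths ⊢
  omega

end attachPaths

theorem B₂_adj {x y : Fin 5} :
    B₂.Adj x y ↔ x ≠ y ∧ (x = 0 ∨ y = 0 ∨ (x.val + 1) / 2 = (y.val + 1) / 2) := by
  fin_cases x <;> fin_cases y <;> simp [B₂]

theorem degree_B₂ [DecidableRel B₂.Adj] (x : Fin 5) : B₂.degree x = if x = 0 then 4 else 2 := by
  rw [← B₂.card_neighborFinset_eq_degree, B₂.neighborFinset_eq_filter]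
  simp only [B₂_adj]
  revert x
  decide

theorem isBicyclic_B₂ : IsBicyclic B₂ := by
  classical
  refine isBicyclic_iff.2 ⟨connected_of_forall_ne_exists_adj_lt 0 fun x hx =>
    ⟨0, Fin.pos_iff_ne_zero.2 hx, B₂_adj.2 ⟨hx.symm, Or.inl rfl⟩⟩, ?_⟩
  simp only [card_interedges_univ_right, degree_B₂]
  rfl

theorem card_filter_eq_of_forall_one_or_two {α : Type*} {A : Finset α} {g : α → ℕ}
    (hg : ∀ x ∈ A, g x = 1 ∨ g x = 2) (c : ℕ) :
    #{x ∈ A | g x = c} =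
      if c = 1 then 2 * #A - ∑ x ∈ A, g x else if c = 2 then ∑ x ∈ A, g x - #A else 0 := by
  have hone : #{x ∈ A | g x = 1} + ∑ x ∈ A, g x = 2 * #A := by
    rw [card_filter, ← sum_add_distrib, mul_comm, ← smul_eq_mul, ← sum_const]
    refine sum_congr rfl fun x hx => ?_
    rcases hg x hx with h | h <;> simp [h]
  have htwo : #{x ∈ A | g x = 2} + #A = ∑ x ∈ A, g x := by
    rw [card_filter, card_eq_sum_ones, ← sum_add_distrib]
    refine sum_congr rfl fun x hx => ?_
    rcases hg x hx with h | h <;> simp [h]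
  split_ifs with h1 h2
  · rw [h1]
    omega
  · rw [h2]
    omega
  · refine card_eq_zero.2 (filter_eq_empty_iff.2 fun x hx hxc => ?_)
    have := hg x hx
    omega

theorem exists_equiv_of_sum_eq {α β : Type*} [Fintype α] [Fintype β] {g : α → ℕ} {h : β → ℕ}
    {a : α} {b : β} (hab : g a = h b) (hg : ∀ x ≠ a, g x = 1 ∨ g x = 2)
    (hh : ∀ y ≠ b, h y = 1 ∨ h y = 2) (hcard : Fintype.card α = Fintype.card β)
    (hsum : ∑ x, g x = ∑ y, h y) : ∃ e : α ≃ β, ∀ x, h (e x) = g x := by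
  classical
  rw [← add_sum_erase _ _ (mem_univ a), ← add_sum_erase _ _ (mem_univ b), hab,
    add_right_inj] at hsum
  have hfiber (c : ℕ) : #{x | g x = c} = #{y | h y = c} := by
    rw [← insert_erase (mem_univ a), ← insert_erase (mem_univ b), filter_insert, filter_insert,
      hab, apply_ite card, apply_ite card, card_insert_of_notMem (by simp),
      card_insert_of_notMem (by simp),
      card_filter_eq_of_forall_one_or_two fun x hx => hg x (ne_of_mem_erase hx),
      card_filter_eq_of_forall_one_or_two fun y hy => hh y (ne_of_mem_erase hy), hsum,
      card_erase_of_mem (mem_univ a), card_erase_of_mem (mem_univ b), card_univ, card_univ, hcard]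
  have e (c : ℕ) : Nonempty ({x // g x = c} ≃ {y // h y = c}) := by
    rw [← Fintype.card_eq, Fintype.card_subtype, Fintype.card_subtype, hfiber]
  exact ⟨Equiv.ofFiberEquiv fun c => (e c).some, fun x => Equiv.ofFiberEquiv_map _ x⟩

section B₂

variable {k : ℕ} {l : Fin k → ℕ} [DecidableRel (attachPaths B₂ 0 l).Adj]

theorem degree_attachPaths_B₂_zero (hl : ∀ i, 1 ≤ l i) :
    (attachPaths B₂ 0 l).degree (.inl 0) = k + 4 := by
  classical
  rw [degree_attachPaths_inl hl, degree_B₂, if_pos rfl, if_pos rfl, add_comm]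

theorem degree_attachPaths_B₂_inl (hl : ∀ i, 1 ≤ l i) {x : Fin 5} (hx : x ≠ 0) :
    (attachPaths B₂ 0 l).degree (.inl x) = 2 := by
  classical
  rw [degree_attachPaths_inl hl, degree_B₂, if_neg hx, if_neg hx]

theorem degree_attachPaths_B₂_eq_one_or_two (hl : ∀ i, 1 ≤ l i)
    {v : Fin 5 ⊕ (i : Fin k) × Fin (l i)} (hv : v ≠ .inl 0) :
    (attachPaths B₂ 0 l).degree v = 1 ∨ (attachPaths B₂ 0 l).degree v = 2 := by
  rcases v with x | ⟨i, s⟩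
  · exact Or.inr (degree_attachPaths_B₂_inl hl fun hx => hv (congrArg Sum.inl hx))
  · rw [degree_attachPaths_inr]
    split_ifs <;> simp

theorem attainsEdgeBound_attachPaths_B₂_zero (hl : ∀ i, 1 ≤ l i)
    (hll : ∀ i j, l i ≤ l j + 1) {t : ℕ} (ht : 2 ≤ t) :
    AttainsEdgeBound (attachPaths B₂ 0 l) {.inl 0} (degreeAtLeast (attachPaths B₂ 0 l) t) := by
  by_cases hlong : t = 2 ∧ ∀ i, 2 ≤ l i
  · obtain ⟨rfl, hlong⟩ := hlong
    refine Or.inl (sum_degree_le_card_interedges fun a ha v hadj => ?_)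
    obtain rfl := mem_singleton.1 ha
    rw [mem_degreeAtLeast]
    rcases v with x | ⟨i, s⟩
    · rw [degree_attachPaths_B₂_inl hl (attachPaths_adj_inl_inl.1 hadj).ne']
    · have := hlong i
      rw [degree_attachPaths_inr, (attachPaths_adj_inl_inr.1 hadj).2, if_pos (by omega)]
  · refine Or.inr (Or.inl (mul_pred_le_card_interedges fun a ha v hv hav => ?_))
    obtain rfl := mem_singleton.1 ha
    rw [mem_degreeAtLeast] at hv
    have hdeg := degree_attachPaths_B₂_eq_one_or_two hl hav.symm
    rcases v with x | ⟨i, s⟩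
    · exact attachPaths_adj_inl_inl.2 (B₂_adj.2 ⟨fun hx => hav (congrArg _ hx), Or.inl rfl⟩)
    · obtain ⟨j, hj⟩ : ∃ j, l j < 2 := by
        by_contra! hlong'
        exact hlong ⟨by omega, hlong'⟩
      have := hll i j
      rw [degree_attachPaths_inr] at hv
      refine attachPaths_adj_inl_inr.2 ⟨rfl, ?_⟩
      split_ifs at hv <;> omega

theorem attainsEdgeBounds_attachPaths_B₂ (hl : ∀ i, 1 ≤ l i) (hll : ∀ i j, l i ≤ l j + 1) :
    AttainsEdgeBounds (attachPaths B₂ 0 l) := by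
  intro s t hst
  rcases le_or_gt t 1 with ht | ht
  · rw [degreeAtLeast_eq_univ (s := t) fun v => ?_]
    · exact Or.inl (card_interedges_univ_right _).ge
    · rcases eq_or_ne v (.inl 0) with rfl | hv
      · rw [degree_attachPaths_B₂_zero hl]
        omega
      · have := degree_attachPaths_B₂_eq_one_or_two hl hv
        omega
  rcases le_or_gt s 2 with hs | hs
  · obtain ⟨rfl, rfl⟩ : s = 2 ∧ t = 2 := by omega
    have huniv := (isBicyclic_iff.1 (isBicyclic_attachPaths (w := 0) hl isBicyclic_B₂)).2
    have hprune := card_interedges_univ_add_le (G := attachPaths B₂ 0 l)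
    have hmax (p : ℕ) : maxEdges p ≤ p + 1 := min_le_right _ _
    have := hmax #(degreeAtLeast (attachPaths B₂ 0 l) 2)
    exact Or.inr (Or.inr (by omega))
  · have hsub : degreeAtLeast (attachPaths B₂ 0 l) s ⊆ {.inl 0} := fun v hv => by
      rw [mem_degreeAtLeast] at hv
      by_contra hne
      have := degree_attachPaths_B₂_eq_one_or_two hl fun h => hne (mem_singleton.2 h)
      omega
    rcases subset_singleton_iff.1 hsub with h | h <;> rw [h]
    · exact Or.inl (Nat.zero_le _)
    · exact attainsEdgeBound_attachPaths_B₂_zero hl hll ht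

end B₂

theorem IsBM₂.attainsEdgeBounds {n d : ℕ} {V : Type*} [Fintype V] {B : SimpleGraph V}
    [DecidableRel B.Adj] (h : IsBM₂ n d B) : AttainsEdgeBounds B := by
  classical
  obtain ⟨-, l, hl, hll, ⟨e⟩⟩ := h
  exact (attainsEdgeBounds_attachPaths_B₂ hl hll).of_iso e.symm

section IsBM₂

variable {n : ℕ} [NeZero n] {π : Fin n → ℕ}

theorem IsBicyclicDegreeSequence.inGamma_attachPaths_B₂ (hπ : IsBicyclicDegreeSequence π)
    (h0 : 5 ≤ π 0) (h1 : π 1 = 2) {l : Fin (π 0 - 4) → ℕ} (hl : ∀ i, 1 ≤ l i)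
    (hcard : Fintype.card (Fin 5 ⊕ (i : Fin (π 0 - 4)) × Fin (l i)) = n) :
    InGamma π (attachPaths B₂ 0 l) := by
  classical
  have hB := isBicyclic_iff.1 (isBicyclic_attachPaths (w := 0) hl isBicyclic_B₂)
  let centre : Fin 5 ⊕ (i : Fin (π 0 - 4)) × Fin (l i) := .inl 0
  refine ⟨hB.1, hasDegreeSequence_iff.2 (exists_equiv_of_sum_eq (a := 0) (b := centre) ?_
    (fun i hi => ?_) (fun v hv => degree_attachPaths_B₂_eq_one_or_two hl hv) ?_ ?_)⟩
  · rw [degree_attachPaths_B₂_zero hl]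
    omega
  · have := hπ.pos i
    have := hπ.le_apply_one hi
    omega
  · rw [hcard, Fintype.card_fin]
  · rw [hπ.sum_eq, ← card_interedges_univ_right, hB.2, hcard]

theorem IsBM₂.inGamma {V : Type*} [Fintype V] {B : SimpleGraph V} (h : IsBM₂ n (π 0) B)
    (hπ : IsBicyclicDegreeSequence π) (h0 : 5 ≤ π 0) (h1 : π 1 = 2) : InGamma π B := by
  obtain ⟨hcard, l, hl, -, ⟨e⟩⟩ := h
  exact (hπ.inGamma_attachPaths_B₂ h0 h1 hl
    (by rw [← Fintype.card_congr e.toEquiv, hcard])).of_iso e.symm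

end IsBM₂

theorem sum_range_add_div (N : ℕ) {k : ℕ} (hk : 0 < k) : ∑ i ∈ range k, (N + i) / k = N := by
  induction N with
  | zero =>
    refine sum_eq_zero fun i hi => ?_
    rw [zero_add, Nat.div_eq_of_lt (mem_range.1 hi)]
  | succ N ih =>
    have hlast := sum_range_succ (fun i => (N + i) / k) k
    rw [sum_range_succ', ih, Nat.add_div_right _ hk, add_zero] at hlast
    simp only [add_right_comm N 1, add_assoc N] at hlast ⊢
    omega

theorem exists_isBM₂ {n k : ℕ} (hk : 1 ≤ k) (hkn : k + 5 ≤ n) :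
    ∃ B : SimpleGraph (Fin n), IsBM₂ n (k + 4) B := by
  let l (i : Fin k) : ℕ := (n - 5 + i) / k
  have hcard : Fintype.card (Fin 5 ⊕ (i : Fin k) × Fin (l i)) = n := by
    simp only [Fintype.card_sum, Fintype.card_sigma, Fintype.card_fin, l]
    rw [Fin.sum_univ_eq_sum_range (fun i => (n - 5 + i) / k), sum_range_add_div _ hk]
    omega
  let e : Fin n ≃ Fin 5 ⊕ (i : Fin k) × Fin (l i) := (Fintype.equivFinOfCardEq hcard).symm
  refine ⟨(attachPaths B₂ 0 l).comap e, Fintype.card_fin n, l, fun i => ?_, fun i j => ?_,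
    ⟨SimpleGraph.Iso.comap e _⟩⟩
  · exact (Nat.one_le_div_iff hk).2 (by omega)
  · rw [← Nat.add_div_right _ hk]
    exact Nat.div_le_div_right (by omega)

/-! ### Graphs given by parents -/

section LinearOrder

variable {V : Type*} [LinearOrder V] (G : SimpleGraph V) [DecidableRel G.Adj]

theorem card_filter_adj_eq_lt_add_gt (B : Finset V) (a : V) :
    #{b ∈ B | G.Adj a b} = #{b ∈ B | b < a ∧ G.Adj b a} + #{b ∈ B | a < b ∧ G.Adj a b} := by
  rw [← card_union_of_disjoint (disjoint_filter.2 fun b _ h h' => h.1.not_gt h'.1), ← filter_or]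
  refine congrArg card (filter_congr fun b _ => ?_)
  rw [G.adj_comm b a, ← or_and_right, and_iff_right_of_imp fun h => h.ne'.lt_or_gt]

theorem card_interedges_eq_sum_lt (A B : Finset V) :
    #(G.interedges A B) =
      ∑ a ∈ A, #{b ∈ B | b < a ∧ G.Adj b a} + ∑ b ∈ B, #{a ∈ A | a < b ∧ G.Adj a b} := by
  have hcomm : ∑ b ∈ B, #{a ∈ A | a < b ∧ G.Adj a b} = ∑ a ∈ A, #{b ∈ B | a < b ∧ G.Adj a b} :=
    (sum_card_bipartiteAbove_eq_sum_card_bipartiteBelow _).symm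
  rw [hcomm, ← sum_add_distrib, card_interedges_eq_sum]
  exact sum_congr rfl fun a _ => card_filter_adj_eq_lt_add_gt G B a

end LinearOrder

theorem IsBicyclic.eq_of_le {V : Type*} [Fintype V] {G H : SimpleGraph V} (hG : IsBicyclic G)
    (hH : IsBicyclic H) (hle : G ≤ H) : G = H :=
  SimpleGraph.edgeSet_injective (Set.eq_of_subset_of_ncard_le (SimpleGraph.edgeSet_mono hle)
    (by rw [hG.2, hH.2]) (Set.toFinite _))

section LowerSet

variable {n : ℕ} {A : Finset (Fin n)}

theorem mem_iff_val_lt_card (hA : IsLowerSet (A : Set (Fin n))) {i : Fin n} :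
    i ∈ A ↔ i.val < #A := by
  refine ⟨fun hi => ?_, fun hlt => ?_⟩
  · have hsub : Iic i ⊆ A := fun j hj => hA (mem_Iic.1 hj) hi
    have := card_le_card hsub
    rwa [Fin.card_Iic] at this
  · by_contra hi
    have hsub : A ⊆ Iio i := fun j hj => mem_Iio.2 (lt_of_not_ge fun hij => hi (hA hij hj))
    have := card_le_card hsub
    rw [Fin.card_Iio] at this
    omega

theorem sum_val_eq_sum_range (hA : IsLowerSet (A : Set (Fin n))) (φ : ℕ → ℕ) :
    ∑ i ∈ A, φ i = ∑ k ∈ range #A, φ k := by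
  have hmap : A.map Fin.valEmbedding = range #A := by
    refine eq_of_subset_of_card_le (fun k hk => ?_) (by simp)
    obtain ⟨i, hi, rfl⟩ := mem_map.1 hk
    exact mem_range.2 ((mem_iff_val_lt_card hA).1 hi)
  rw [← hmap, sum_map]
  rfl

end LowerSet

/-- The number of neighbours of the vertex `j` among `0, …, j - 1` in `parentGraph`. -/
def backDegree (j : ℕ) : ℕ := if j < 4 then min j 2 else 1

theorem maxEdges_of_four_le {p : ℕ} (hp : 4 ≤ p) : maxEdges p = p + 1 := by
  refine min_eq_right ?_
  rw [Nat.choose_two_right, Nat.le_div_iff_mul_le two_pos]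
  obtain ⟨m, rfl⟩ := Nat.exists_eq_add_of_le' hp
  rw [Nat.add_sub_assoc (by norm_num)]
  nlinarith

theorem sum_backDegree (p : ℕ) : ∑ j ∈ range p, backDegree j = maxEdges p := by
  rcases lt_or_ge p 4 with hp | hp
  · interval_cases p <;> rfl
  · induction p, hp using Nat.le_induction with
    | base => rfl
    | succ p hp ih =>
      rw [sum_range_succ, ih, maxEdges_of_four_le hp, maxEdges_of_four_le (by omega), backDegree,
        if_neg (by omega)]

/-- The graph that consists of the triangles `012` and `013` and of the edges from the later
vertices to their parents. A BFS-graph whose base graph is `B₁`, located on the first four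
vertices, has this form. The values of `par` at `0, 1, 2, 3` are not used. -/
def parentGraph {n : ℕ} (par : Fin n → Fin n) : SimpleGraph (Fin n) :=
  SimpleGraph.fromRel fun i j => (i.val < 2 ∧ j.val < 4) ∨ (4 ≤ j.val ∧ i = par j)

/-- Each vertex after the first four has a parent preceding it. -/
def IsParentMap {n : ℕ} (par : Fin n → Fin n) : Prop :=
  ∀ j : Fin n, 4 ≤ j.val → par j < j

section parentGraph

variable {n : ℕ} {par : Fin n → Fin n}

theorem parentGraph_adj_iff_of_lt (hpar : IsParentMap par) {i j : Fin n} (hij : i < j) :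
    (parentGraph par).Adj i j ↔ (i.val < 2 ∧ j.val < 4) ∨ (4 ≤ j.val ∧ i = par j) := by
  rw [parentGraph, SimpleGraph.fromRel_adj, and_iff_right hij.ne, or_iff_left_of_imp]
  rintro (⟨hj, -⟩ | ⟨hi, rfl⟩)
  · exact Or.inl (by omega)
  · exact absurd (hpar i hi) hij.not_gt

theorem parentGraph_adj_par (hpar : IsParentMap par) {j : Fin n} (hj : 4 ≤ j.val) :
    (parentGraph par).Adj (par j) j :=
  (parentGraph_adj_iff_of_lt hpar (hpar j hj)).2 (Or.inr ⟨hj, rfl⟩)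

theorem card_filter_lt_adj_parentGraph [DecidableRel (parentGraph par).Adj]
    (hpar : IsParentMap par) {A : Finset (Fin n)} (hA : IsLowerSet (A : Set (Fin n)))
    (htwo : 2 ≤ #A) {j : Fin n} (hj : 4 ≤ j.val → par j ∈ A) :
    #{i ∈ A | i < j ∧ (parentGraph par).Adj i j} = backDegree j := by
  rw [filter_congr fun i _ => and_congr_right fun hij => parentGraph_adj_iff_of_lt hpar hij,
    backDegree]
  split_ifs with hj4
  · have hmin : min j.val 2 < n := by omega
    refine Eq.trans (congrArg card ?_) (Fin.card_Iio ⟨min j.val 2, hmin⟩)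
    ext i
    simp only [mem_filter, mem_iff_val_lt_card hA, mem_Iio, Fin.lt_def]
    omega
  · refine card_eq_one.2 ⟨par j, ?_⟩
    ext i
    have := hpar j (by omega)
    grind

theorem isBicyclic_parentGraph (hpar : IsParentMap par) (hn : 4 ≤ n) :
    IsBicyclic (parentGraph par) := by
  classical
  have : NeZero n := ⟨by omega⟩
  have huniv : IsLowerSet ((univ : Finset (Fin n)) : Set (Fin n)) := fun i _ _ _ => mem_univ _
  refine isBicyclic_iff.2
    ⟨connected_of_forall_ne_exists_adj_lt 0 fun j hj => ?_, ?_⟩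
  · rcases lt_or_ge j.val 4 with hj4 | hj4
    · have hlt : 0 < j := Fin.pos_iff_ne_zero.2 hj
      exact ⟨_, hlt, (parentGraph_adj_iff_of_lt hpar hlt).2 (Or.inl ⟨by simp, hj4⟩)⟩
    · exact ⟨_, hpar j hj4, parentGraph_adj_par hpar hj4⟩
  · have hback (j : Fin n) := card_filter_lt_adj_parentGraph hpar huniv
      (by rw [card_fin]; omega) fun _ => mem_univ (par j)
    rw [card_interedges_eq_sum_lt, sum_congr rfl fun j _ => hback j, sum_val_eq_sum_range huniv,
      sum_backDegree, card_fin, maxEdges_of_four_le hn, Fintype.card_fin, two_mul]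

variable [DecidableRel (parentGraph par).Adj]

theorem maxEdges_add_maxEdges_le_card_interedges_parentGraph (hpar : IsParentMap par)
    {A B : Finset (Fin n)} (hA : IsLowerSet (A : Set (Fin n))) (hB : IsLowerSet (B : Set (Fin n)))
    (htwo : 2 ≤ #A) (hAB : A ⊆ B) (hparA : ∀ j ∈ B, 4 ≤ j.val → par j ∈ A) :
    maxEdges #A + maxEdges #B ≤ #((parentGraph par).interedges A B) := by
  rw [card_interedges_eq_sum_lt, ← sum_backDegree, ← sum_backDegree, ← sum_val_eq_sum_range hA,
    ← sum_val_eq_sum_range hB]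
  refine (congrArg₂ _ (sum_congr rfl fun j hj => ?_) (sum_congr rfl fun j hj => ?_)).ge
  · exact card_filter_lt_adj_parentGraph hpar hB (htwo.trans (card_le_card hAB))
      fun hj4 => hB (hpar j hj4).le (hAB hj)
  · exact card_filter_lt_adj_parentGraph hpar hA htwo fun hj4 => hparA j hj hj4

theorem attainsEdgeBounds_parentGraph (hpar : IsParentMap par)
    (hmono : MonotoneOn par {j | 4 ≤ j.val}) (hdeg : Antitone fun i => (parentGraph par).degree i) :
    AttainsEdgeBounds (parentGraph par) := by
  intro s t hst
  have hlower (r : ℕ) : IsLowerSet (degreeAtLeast (parentGraph par) r : Set (Fin n)) :=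
    fun i j hji hi => by
      rw [mem_coe, mem_degreeAtLeast] at hi ⊢
      exact hi.trans (hdeg hji)
  have hAB := degreeAtLeast_antitone (G := parentGraph par) hst
  have hA := hlower s
  have hB := hlower t
  set A := degreeAtLeast (parentGraph par) s
  set B := degreeAtLeast (parentGraph par) t
  by_cases hparA : ∀ j ∈ B, 4 ≤ j.val → par j ∈ A
  · rcases le_or_gt 2 #A with htwo | hone
    · exact Or.inr (Or.inr (maxEdges_add_maxEdges_le_card_interedges_parentGraph hpar hA hB
        htwo hAB hparA))
    · have hzero {i : Fin n} (hi : i ∈ A) : i.val = 0 := by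
        have := (mem_iff_val_lt_card hA).1 hi
        omega
      refine Or.inr (Or.inl (mul_pred_le_card_interedges fun a ha b hb hab => ?_))
      have hlt : a < b := lt_of_le_of_ne (Fin.le_def.2 ((hzero ha).trans_le (Nat.zero_le _))) hab
      refine (parentGraph_adj_iff_of_lt hpar hlt).2 ((lt_or_ge b.val 4).imp (fun h => ⟨?_, h⟩)
        fun h => ⟨h, Fin.ext ?_⟩)
      · rw [hzero ha]
        exact two_pos
      · rw [hzero ha, hzero (hparA b hb h)]
  · push Not at hparA
    obtain ⟨j, hj, hj4, hjA⟩ := hparA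
    refine Or.inl (sum_degree_le_card_interedges fun a ha b hadj => ?_)
    by_contra hb
    have hlt {i : Fin n} (hi : i ∈ B) : i < b := lt_of_not_ge fun h => hb (hB h hi)
    rcases (parentGraph_adj_iff_of_lt hpar (hlt (hAB ha))).1 hadj with h | ⟨hb4, rfl⟩
    · have := Fin.lt_def.1 (hlt hj)
      omega
    · exact hjA (hA (hmono hj4 hb4 (hlt hj).le) ha)

end parentGraph

section IsBM₁

theorem exists_adj_dist_eq_add_one {V : Type*} {G : SimpleGraph V} (hG : G.Connected) {r x : V}
    (hx : x ≠ r) : ∃ y, G.Adj y x ∧ G.dist r x = G.dist r y + 1 := by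
  obtain ⟨p, hp⟩ := hG.exists_walk_length_eq_dist x r
  cases p with
  | nil => exact absurd rfl hx
  | @cons _ y _ hxy p =>
    refine ⟨y, hxy.symm, ?_⟩
    have htail := SimpleGraph.dist_le p
    have htriangle := hG.dist_triangle (u := x) (v := y) (w := r)
    rw [SimpleGraph.dist_eq_one_iff_adj.2 hxy] at htriangle
    rw [SimpleGraph.Walk.length_cons] at hp
    rw [G.dist_comm, G.dist_comm (u := r)]
    omega

theorem B₁_adj {i j : Fin 4} : B₁.Adj i j ↔ i ≠ j ∧ (i.val < 2 ∨ j.val < 2) := by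
  fin_cases i <;> fin_cases j <;> simp [B₁]

theorem adj_of_iso_baseGraph {n : ℕ} [NeZero n] {V : Type*} {B : SimpleGraph V} {v : Fin n → V}
    (φ : B₁ ≃g baseGraph B) (h0 : (φ 0 : V) = v 0) (h1 : (φ 1 : V) = v 1) (h2 : (φ 2 : V) = v 2)
    (h3 : (φ 3 : V) = v 3) (hn : 4 ≤ n) {i j : Fin n} (hij : i ≠ j) (hi : i.val < 2)
    (hj : j.val < 4) : B.Adj (v i) (v j) := by
  have hφ (i : Fin 4) : (φ i : V) = v (Fin.castLE hn i) := by
    fin_cases i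
    · exact h0
    · exact h1.trans (congrArg v (Fin.ext (Nat.mod_eq_of_lt (by omega : 1 < n))))
    · exact h2.trans (congrArg v (Fin.ext (Nat.mod_eq_of_lt (by omega : 2 < n))))
    · exact h3.trans (congrArg v (Fin.ext (Nat.mod_eq_of_lt (by omega : 3 < n))))
  have hadj : B₁.Adj ⟨i, by omega⟩ ⟨j, hj⟩ :=
    B₁_adj.2 ⟨fun h => hij (Fin.ext (Fin.mk.inj h)), Or.inl hi⟩
  have : B.Adj (φ ⟨i, by omega⟩) (φ ⟨j, hj⟩) := φ.map_adj_iff.2 hadj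
  rwa [hφ, hφ] at this

variable {n : ℕ} [NeZero n] {π : Fin n → ℕ} {V : Type*} [Fintype V] {B : SimpleGraph V}

theorem IsBFSOrdering.exists_parent {v : Fin n ≃ V} (hv : IsBFSOrdering B v) {j : Fin n}
    (hj : j ≠ 0) : ∃ i < j, B.Adj (v i) (v j) ∧ B.dist (v 0) (v j) = B.dist (v 0) (v i) + 1 := by
  obtain ⟨y, hadj, hdist⟩ := exists_adj_dist_eq_add_one hv.connected (v.injective.ne hj)
  refine ⟨v.symm y, lt_of_not_ge fun hle => ?_, by rwa [v.apply_symm_apply],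
    by rwa [v.apply_symm_apply]⟩
  have := hv.height_mono _ _ hle
  rw [v.apply_symm_apply] at this
  omega

theorem IsBFSOrdering.monotoneOn_parent {v : Fin n ≃ V} (hv : IsBFSOrdering B v)
    {par : Fin n → Fin n} (hpar : IsParentMap par) (hB : parentGraph par = B.comap v)
    (hdist : ∀ j, 4 ≤ j.val → B.dist (v 0) (v j) = B.dist (v 0) (v (par j)) + 1) :
    MonotoneOn par {j | 4 ≤ j.val} := by
  intro i (hi : 4 ≤ i.val) j (hj : 4 ≤ j.val) hij
  by_contra! hlt
  have hadj {a b : Fin n} : B.Adj (v a) (v b) ↔ (parentGraph par).Adj a b := by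
    rw [hB, SimpleGraph.comap_adj]
  have hadj_iff {a b : Fin n} (hb : 4 ≤ b.val) (hab : a < b) :
      B.Adj (v a) (v b) ↔ a = par b := by
    rw [hadj, parentGraph_adj_iff_of_lt hpar hab, and_iff_right hb, or_iff_right (by omega)]
  have hparj : par j < i := hlt.trans (hpar i hi)
  have hheight : B.dist (v 0) (v (par i)) = B.dist (v 0) (v (par j)) := by
    have := hv.height_mono _ _ hlt.le
    have := hv.height_mono _ _ hij
    have := hdist i hi
    have := hdist j hj
    omega
  refine (hv.children (par j) (par i) j i ?_ ?_ ?_ ?_ hheight.symm (hdist j hj) ?_ hlt).not_ge hij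
  · exact hadj.2 (parentGraph_adj_par hpar hj)
  · exact fun h => hlt.ne' ((hadj_iff hj ((hpar i hi).trans_le hij)).1 h)
  · exact hadj.2 (parentGraph_adj_par hpar hi)
  · exact fun h => hlt.ne ((hadj_iff hi hparj).1 h)
  · rw [hdist i hi, hheight]

theorem IsBM₁.inGamma (h : IsBM₁ π B) : InGamma π B := by
  obtain ⟨v, hdeg, hbfs, -⟩ := h
  exact ⟨hbfs.connected, v, hdeg⟩

theorem IsBM₁.exists_iso_parentGraph (h : IsBM₁ π B) (hπ : IsBicyclicDegreeSequence π) :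
    ∃ (par : Fin n → Fin n) (e : parentGraph par ≃g B), IsParentMap par ∧
      MonotoneOn par {j | 4 ≤ j.val} ∧ IsBFSOrdering B e.toEquiv := by
  have hγ := h.inGamma
  obtain ⟨v, -, hbfs, φ, h0, h1, h2, h3⟩ := h
  have hparent (j : Fin n) : ∃ i, 4 ≤ j.val →
      i < j ∧ B.Adj (v i) (v j) ∧ B.dist (v 0) (v j) = B.dist (v 0) (v i) + 1 := by
    by_cases hj : 4 ≤ j.val
    · obtain ⟨i, hi⟩ := hbfs.exists_parent (j := j) (fun h => by simp [h] at hj)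
      exact ⟨i, fun _ => hi⟩
    · exact ⟨j, fun h => absurd h hj⟩
  choose par hpar using hparent
  have hparentMap : IsParentMap par := fun j hj => (hpar j hj).1
  have hle : parentGraph par ≤ B.comap v := by
    have hlt {i j : Fin n} (hij : i < j) (hadj : (parentGraph par).Adj i j) :
        B.Adj (v i) (v j) := by
      rcases (parentGraph_adj_iff_of_lt hparentMap hij).1 hadj with ⟨hi, hj⟩ | ⟨hj, rfl⟩
      · exact adj_of_iso_baseGraph φ h0 h1 h2 h3 hπ.four_le hij.ne hi hj
      · exact (hpar j hj).2.1
    intro i j hadj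
    exact hadj.ne.lt_or_gt.elim (hlt · hadj) fun hji => (hlt hji hadj.symm).symm
  have heq : parentGraph par = B.comap v :=
    (isBicyclic_parentGraph hparentMap hπ.four_le).eq_of_le
      (hπ.isBicyclic (hγ.of_iso (SimpleGraph.Iso.comap v B).symm)) hle
  exact ⟨par, ⟨v, fun {a b} => by rw [heq, SimpleGraph.comap_adj]⟩, hparentMap,
    hbfs.monotoneOn_parent hparentMap heq fun j hj => (hpar j hj).2.2, hbfs⟩

theorem IsBM₁.attainsEdgeBounds [DecidableRel B.Adj] (h : IsBM₁ π B)
    (hπ : IsBicyclicDegreeSequence π) : AttainsEdgeBounds B := by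
  classical
  obtain ⟨par, e, hpar, hmono, hbfs⟩ := h.exists_iso_parentGraph hπ
  refine (attainsEdgeBounds_parentGraph hpar hmono fun i j hij => ?_).of_iso e
  have hle : B.degree (e.toEquiv j) ≤ B.degree (e.toEquiv i) := by
    convert hbfs.degree_anti i j hij
  exact (e.degree_eq j).symm.trans_le (hle.trans_eq (e.degree_eq i))

end IsBM₁

/-! ### Breadth-first orderings of parent graphs -/

theorem dist_eq_of_forall_adj_le_add_one {V : Type*} {G : SimpleGraph V} {r : V} {h : V → ℕ}
    (hr : h r = 0) (hadj : ∀ u v, G.Adj u v → h v ≤ h u + 1)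
    (hpar : ∀ v ≠ r, ∃ u, G.Adj u v ∧ h v = h u + 1) (v : V) : G.dist r v = h v := by
  have hwalk : ∀ k, ∀ v, h v = k → ∃ p : G.Walk r v, p.length = k := by
    intro k
    induction k with
    | zero =>
      intro v hv
      obtain rfl : v = r := by
        by_contra hne
        obtain ⟨u, -, hu⟩ := hpar v hne
        omega
      exact ⟨.nil, rfl⟩
    | succ k ih =>
      intro v hv
      obtain ⟨u, huv, hu⟩ := hpar v (by rintro rfl; omega)
      obtain ⟨p, hp⟩ := ih u (by omega)
      exact ⟨p.concat huv, by rw [SimpleGraph.Walk.length_concat, hp]⟩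
  have hlength {a b : V} (p : G.Walk a b) : h b ≤ h a + p.length := by
    induction p with
    | nil => simp
    | @cons a c b hac p ih =>
      have := hadj a c hac
      rw [SimpleGraph.Walk.length_cons]
      omega
  obtain ⟨p, hp⟩ := hwalk _ v rfl
  obtain ⟨q, hq⟩ := p.reachable.exists_walk_length_eq_dist
  have := hlength q
  have := SimpleGraph.dist_le p
  omega

/-- The distance to the vertex `0` in `parentGraph par`, if `par` is a parent map. The condition
`par j < j` only serves to make the recursion well-founded. -/
def height {n : ℕ} (par : Fin n → Fin n) (j : Fin n) : ℕ :=
  if 4 ≤ j.val ∧ par j < j then height par (par j) + 1 else min j.val 1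
termination_by j
decreasing_by omega

section parentGraph

variable {n : ℕ} {par : Fin n → Fin n}

theorem height_of_lt_four {j : Fin n} (hj : j.val < 4) : height par j = min j.val 1 := by
  rw [height, if_neg (by omega)]

theorem height_of_four_le (hpar : IsParentMap par) {j : Fin n} (hj : 4 ≤ j.val) :
    height par j = height par (par j) + 1 := by
  rw [height, if_pos ⟨hj, hpar j hj⟩]

theorem height_pos (hpar : IsParentMap par) {j : Fin n} (hj : 0 < j.val) : 0 < height par j := by
  rcases lt_or_ge j.val 4 with hj4 | hj4
  · rw [height_of_lt_four hj4]
    omega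
  · rw [height_of_four_le hpar hj4]
    omega

theorem monotone_height (hpar : IsParentMap par) (hmono : MonotoneOn par {j | 4 ≤ j.val}) :
    Monotone (height par) := by
  intro i j hij
  induction j using WellFoundedLT.induction generalizing i with
  | ind j ih =>
    rcases lt_or_ge i.val 4 with hi | hi
    · rw [height_of_lt_four hi]
      rcases Nat.eq_zero_or_pos i.val with hi0 | hi0
      · omega
      · have := height_pos hpar (hi0.trans_le hij)
        omega
    · have hj : 4 ≤ j.val := hi.trans hij
      rw [height_of_four_le hpar hi, height_of_four_le hpar hj]
      exact Nat.succ_le_succ (ih _ (hpar j hj) (hmono hi hj hij))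

theorem four_le_and_eq_par_of_height_lt (hpar : IsParentMap par)
    (hmono : MonotoneOn par {j | 4 ≤ j.val}) {i j : Fin n} (hadj : (parentGraph par).Adj i j)
    (hpos : 0 < height par i) (hlt : height par i < height par j) : 4 ≤ j.val ∧ i = par j := by
  have hij : i < j := lt_of_not_ge fun hji => (monotone_height hpar hmono hji).not_gt hlt
  refine ((parentGraph_adj_iff_of_lt hpar hij).1 hadj).resolve_left fun ⟨_, hj⟩ => ?_
  rw [height_of_lt_four hj] at hlt
  omega

theorem dist_parentGraph [NeZero n] (hpar : IsParentMap par)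
    (hmono : MonotoneOn par {j | 4 ≤ j.val}) (j : Fin n) :
    (parentGraph par).dist 0 j = height par j := by
  refine dist_eq_of_forall_adj_le_add_one (height_of_lt_four (by simp)) (fun i j hadj => ?_)
    (fun j hj => ?_) j
  · rcases hadj.ne.lt_or_gt with hlt | hlt
    · rcases (parentGraph_adj_iff_of_lt hpar hlt).1 hadj with ⟨hi, hj⟩ | ⟨hj, rfl⟩
      · rw [height_of_lt_four hj]
        omega
      · exact (height_of_four_le hpar hj).le
    · exact (monotone_height hpar hmono hlt.le).trans (Nat.le_succ _)
  · rcases lt_or_ge j.val 4 with hj4 | hj4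
    · have hlt : 0 < j := Fin.pos_iff_ne_zero.2 hj
      refine ⟨0, (parentGraph_adj_iff_of_lt hpar hlt).2 (Or.inl ⟨by simp, hj4⟩), ?_⟩
      rw [height_of_lt_four hj4, height_of_lt_four (by simp), Fin.val_zero]
      exact min_eq_right hlt
    · exact ⟨par j, parentGraph_adj_par hpar hj4, height_of_four_le hpar hj4⟩

open Classical in
theorem isBFSOrdering_parentGraph [NeZero n] (hpar : IsParentMap par)
    (hmono : MonotoneOn par {j | 4 ≤ j.val}) (hdeg : Antitone fun i => (parentGraph par).degree i)
    (hn : 4 ≤ n) : IsBFSOrdering (parentGraph par) (Equiv.refl _) := by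
  have hheight := monotone_height hpar hmono
  refine ⟨(isBicyclic_parentGraph hpar hn).1, fun i j hij => hdeg hij, fun i j hij => ?_,
    fun u w x z hux _ hwz _ huw hx hz hlt => ?_⟩
  · simpa only [Equiv.refl_apply, dist_parentGraph hpar hmono] using hheight hij
  · simp only [Equiv.refl_apply, dist_parentGraph hpar hmono] at *
    have hpos : 0 < height par w := height_pos hpar (by omega)
    obtain ⟨hx4, rfl⟩ := four_le_and_eq_par_of_height_lt hpar hmono hux (by omega) (by omega)
    obtain ⟨hz4, rfl⟩ := four_le_and_eq_par_of_height_lt hpar hmono hwz hpos (by omega)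
    exact lt_of_not_ge fun hzx => (hmono hz4 hx4 hzx).not_gt hlt

end parentGraph

/-! ### The base graph of a parent graph -/

theorem prune_mono {V : Type*} [Finite V] {G : SimpleGraph V} {S T : Set V} (hST : S ⊆ T) :
    prune G S ⊆ prune G T := fun _ hx =>
  ⟨hST hx.1, hx.2.trans (Set.ncard_le_ncard (Set.inter_subset_inter_right _ hST)
    (Set.toFinite _))⟩

theorem subset_baseSet {V : Type*} [Finite V] {G : SimpleGraph V} {S : Set V}
    (hS : S ⊆ prune G S) : S ⊆ baseSet G := by
  refine Set.subset_iInter fun k => ?_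
  induction k with
  | zero => exact Set.subset_univ S
  | succ k ih =>
    rw [Function.iterate_succ_apply']
    exact hS.trans (prune_mono ih)

theorem val_lt_of_mem_baseSet {n m : ℕ} {G : SimpleGraph (Fin n)}
    (hG : ∀ x : Fin n, m ≤ x.val → {y | y < x ∧ G.Adj x y}.Subsingleton) {x : Fin n}
    (hx : x ∈ baseSet G) : x.val < m := by
  have hprune : ∀ k, ∀ x : Fin n, x ∈ (prune G)^[k] Set.univ → m ≤ x.val → x.val + k < n := by
    intro k
    induction k with
    | zero => exact fun x _ _ => x.2
    | succ k ih =>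
      intro x hx hm
      rw [Function.iterate_succ_apply'] at hx
      by_contra! hk
      refine hx.2.not_gt (Nat.lt_succ_of_le (Set.ncard_le_one_iff_subsingleton.2
        ((hG x hm).anti fun y hy => ⟨lt_of_not_ge fun hxy => ?_, hy.1⟩)))
      have hlt : x.val < y.val := lt_of_le_of_ne hxy fun h => hy.1.ne (Fin.ext h)
      have := ih y hy.2 (hm.trans hxy)
      omega
  by_contra! hm
  have := hprune n x (Set.mem_iInter.1 hx n) hm
  omega

section parentGraph

variable {n : ℕ} {par : Fin n → Fin n}

theorem parentGraph_adj_castLE (hn : 4 ≤ n) {i j : Fin 4} :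
    (parentGraph par).Adj (i.castLE hn) (j.castLE hn) ↔ B₁.Adj i j := by
  rw [B₁_adj, parentGraph, SimpleGraph.fromRel_adj, Fin.val_castLE, Fin.val_castLE, ne_eq,
    Fin.castLE_inj]
  omega

theorem baseSet_parentGraph (hpar : IsParentMap par) (hn : 4 ≤ n) :
    baseSet (parentGraph par) = {x | x.val < 4} := by
  refine Set.Subset.antisymm (fun x hx => val_lt_of_mem_baseSet (fun x hx => ?_) hx)
    (subset_baseSet fun x hx => ⟨hx, ?_⟩)
  · have hadj {y} (hlt : y < x) (hadj : (parentGraph par).Adj x y) : y = par x :=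
      (((parentGraph_adj_iff_of_lt hpar hlt).1 hadj.symm).resolve_left (by omega)).2
    exact fun y hy z hz => (hadj hy.1 hy.2).trans (hadj hz.1 hz.2).symm
  · have hnbrs : ∀ i, ∃ j k, j ≠ k ∧ B₁.Adj i j ∧ B₁.Adj i k := by
      simp only [B₁_adj]
      decide
    obtain ⟨j, k, hjk, hj, hk⟩ := hnbrs ⟨x, hx⟩
    exact (Set.one_lt_ncard_iff (Set.toFinite _)).2 ⟨j.castLE hn, k.castLE hn,
      ⟨(parentGraph_adj_castLE hn).2 hj, j.2⟩, ⟨(parentGraph_adj_castLE hn).2 hk, k.2⟩,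
      fun h => hjk (Fin.castLE_inj.1 h)⟩

theorem exists_iso_baseGraph_parentGraph (hpar : IsParentMap par) (hn : 4 ≤ n) :
    ∃ φ : B₁ ≃g baseGraph (parentGraph par), ∀ i, (φ i : Fin n) = i.castLE hn := by
  have hmem {x : Fin n} : x ∈ baseSet (parentGraph par) ↔ x.val < 4 := by
    rw [baseSet_parentGraph hpar hn, Set.mem_ofPred_eq]
  refine ⟨⟨⟨fun i => ⟨i.castLE hn, hmem.2 i.2⟩, fun x => ⟨x.1, hmem.1 x.2⟩, fun _ => rfl,
    fun _ => rfl⟩, parentGraph_adj_castLE hn⟩, fun _ => rfl⟩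

/-- The number of neighbours of the vertex `i` of `parentGraph` that are not its children. -/
def coreDegree (i : ℕ) : ℕ := if i < 2 then 3 else if i < 4 then 2 else 1

theorem card_filter_gt_adj_parentGraph [DecidableRel (parentGraph par).Adj]
    (hpar : IsParentMap par) (hn : 4 ≤ n) (i : Fin n) :
    #{j | i < j ∧ (parentGraph par).Adj i j} =
      (if i.val < 2 then 3 - i.val else 0) + #{j : Fin n | 4 ≤ j.val ∧ par j = i} := by
  have hcore : #{j : Fin n | i < j ∧ i.val < 2 ∧ j.val < 4} =
      if i.val < 2 then 3 - i.val else 0 := by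
    split_ifs with hi
    · refine Eq.trans (congrArg card ?_) (Fin.card_Ioc i ⟨3, hn⟩)
      ext j
      simp only [mem_filter, mem_univ, mem_Ioc, Fin.lt_def, Fin.le_def, true_and]
      omega
    · exact card_eq_zero.2 (filter_eq_empty_iff.2 fun j _ h => hi h.2.1)
  have hchildren : #{j | i < j ∧ 4 ≤ j.val ∧ i = par j} = #{j | 4 ≤ j.val ∧ par j = i} := by
    refine congrArg card (filter_congr fun j _ => ⟨fun h => ⟨h.2.1, h.2.2.symm⟩, ?_⟩)
    rintro ⟨hj, rfl⟩
    exact ⟨hpar j hj, hj, rfl⟩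
  rw [filter_congr fun j _ => and_congr_right (parentGraph_adj_iff_of_lt hpar),
    filter_congr fun j _ => and_or_left, filter_or, card_union_of_disjoint, hcore, hchildren]
  exact disjoint_filter.2 fun j _ h h' => absurd h.2.2 (by omega)

theorem degree_parentGraph [DecidableRel (parentGraph par).Adj] (hpar : IsParentMap par)
    (hn : 4 ≤ n) (i : Fin n) : (parentGraph par).degree i =
      coreDegree i + #{j : Fin n | 4 ≤ j.val ∧ par j = i} := by
  have hback := card_filter_lt_adj_parentGraph hpar (A := univ) (fun _ _ _ _ => mem_univ _)
    (by rw [card_fin]; omega) (j := i) fun _ => mem_univ _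
  have hcore : coreDegree i = backDegree i + if i.val < 2 then 3 - i.val else 0 := by
    unfold coreDegree backDegree
    split_ifs <;> omega
  rw [← SimpleGraph.card_neighborFinset_eq_degree, SimpleGraph.neighborFinset_eq_filter,
    card_filter_adj_eq_lt_add_gt, hback, card_filter_gt_adj_parentGraph hpar hn, hcore, add_assoc]

end parentGraph

/-! ### Parents with prescribed numbers of children -/

section ParentMap

variable {n : ℕ}

theorem exists_isParentMap_of_monotone {R : ℕ → ℕ} (hR : Monotone R) (h0 : R 0 = 0)
    (hlt : ∀ j, 4 ≤ j → j < n → j < R j + 4) :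
    ∃ par : Fin n → Fin n, IsParentMap par ∧ ∀ i j, 4 ≤ j.val →
      (par j = i ↔ R i + 4 ≤ j ∧ j < R (i + 1) + 4) := by
  have hparent (j : Fin n) : ∃ i : Fin n, 4 ≤ j.val →
      i < j ∧ R i + 4 ≤ j ∧ j < R (i + 1) + 4 := by
    by_cases hj : 4 ≤ j.val
    · have hmem : j.val - 3 ∈ Set.Ioc (R 0) (R j) := by
        have := hlt j hj j.2
        exact ⟨by omega, by omega⟩
      rw [← hR.biUnion_Ico_Ioc_map_succ, Set.mem_iUnion₂] at hmem
      obtain ⟨i, hi, hlo, hhi⟩ := hmem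
      rw [Nat.succ_eq_succ, Nat.succ_eq_add_one] at hhi
      exact ⟨⟨i, hi.2.trans j.2⟩, fun _ => ⟨hi.2, by simp only; omega, by simp only; omega⟩⟩
    · exact ⟨j, fun h => absurd h hj⟩
  choose par hpar using hparent
  refine ⟨par, fun j hj => (hpar j hj).1, fun i j hj => ⟨?_, fun hj' => ?_⟩⟩
  · rintro rfl
    exact (hpar j hj).2
  · obtain ⟨-, hlo', hhi'⟩ := hpar j hj
    rcases lt_trichotomy (par j) i with hlt | heq | hlt
    · have := hR (show (par j).val + 1 ≤ i from hlt)
      omega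
    · exact heq
    · have := hR (show i.val + 1 ≤ par j from hlt)
      omega

theorem exists_isParentMap_card_eq {e : ℕ → ℕ} (hsum : ∑ k ∈ range n, e k + 4 = n)
    (hlt : ∀ j, 4 ≤ j → j < n → j < ∑ k ∈ range j, e k + 4) :
    ∃ par : Fin n → Fin n, IsParentMap par ∧ MonotoneOn par {j | 4 ≤ j.val} ∧
      ∀ i : Fin n, #{j : Fin n | 4 ≤ j.val ∧ par j = i} = e i := by
  have hR : Monotone fun i => ∑ k ∈ range i, e k := fun i j hij =>
    sum_le_sum_of_subset (range_subset_range.2 hij)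
  obtain ⟨par, hpar, hiff⟩ := exists_isParentMap_of_monotone hR (sum_range_zero e) hlt
  refine ⟨par, hpar, fun i hi j hj hij => le_of_not_gt fun hgt => ?_, fun i => ?_⟩
  · have := hR (show (par j).val + 1 ≤ par i from hgt)
    have := ((hiff _ i hi).1 rfl).1
    have := ((hiff _ j hj).1 rfl).2
    beta_reduce at *
    omega
  · have hn := hR (show i.val + 1 ≤ n from i.2)
    have hsucc := sum_range_succ e i
    have hIco : ({j | 4 ≤ j.val ∧ par j = i} : Finset (Fin n)).map Fin.valEmbedding =
        Ico (∑ k ∈ range i, e k + 4) (∑ k ∈ range (i + 1), e k + 4) := by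
      ext k
      simp only [mem_map, mem_filter, mem_univ, true_and, mem_Ico, Fin.valEmbedding_apply]
      constructor
      · rintro ⟨j, ⟨hj, hij⟩, rfl⟩
        exact (hiff i j hj).1 hij
      · intro hk
        have hk4 : 4 ≤ k := by omega
        have hkn : k < n := by beta_reduce at hn; omega
        exact ⟨⟨k, hkn⟩, ⟨hk4, (hiff i ⟨k, hkn⟩ hk4).2 hk⟩, rfl⟩
    rw [← card_map Fin.valEmbedding, hIco, Nat.card_Ico, hsucc]
    omega

end ParentMap

theorem lt_sum_range_add {e : ℕ → ℕ} {m n j : ℕ} (hanti : AntitoneOn e (Set.Ico m n))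
    (hsum : ∑ k ∈ range n, e k + m = n) (hm : 1 ≤ ∑ k ∈ range m, e k) (hmj : m ≤ j)
    (hjn : j < n) : j < ∑ k ∈ range j, e k + m := by
  have hj : j ∈ Set.Ico m n := ⟨hmj, hjn⟩
  rcases Nat.eq_zero_or_pos (e j) with hzero | hpos
  · have htail : ∑ k ∈ Ico j n, e k = 0 := sum_eq_zero fun k hk => by
      rw [mem_Ico] at hk
      exact Nat.eq_zero_of_le_zero ((hanti hj ⟨hmj.trans hk.1, hk.2⟩ hk.1).trans hzero.le)
    have := sum_range_add_sum_Ico e hjn.le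
    omega
  · have hhead : #(Ico m j) • 1 ≤ ∑ k ∈ Ico m j, e k := card_nsmul_le_sum _ _ _ fun k hk => by
      rw [mem_Ico] at hk
      exact hpos.trans_le (hanti ⟨hk.1, hk.2.trans hjn⟩ hj hk.2.le)
    rw [Nat.card_Ico, smul_eq_mul, mul_one] at hhead
    have := sum_range_add_sum_Ico e hmj
    omega

theorem sum_coreDegree {n : ℕ} (hn : 4 ≤ n) : ∑ k ∈ range n, coreDegree k = n + 6 := by
  induction n, hn using Nat.le_induction with
  | base => rfl
  | succ n hn ih =>
    rw [sum_range_succ, ih, coreDegree, if_neg (by omega), if_neg (by omega)]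

namespace IsBicyclicDegreeSequence

variable {n : ℕ} [NeZero n] {π : Fin n → ℕ}

theorem coreDegree_le (hπ : IsBicyclicDegreeSequence π) (h1 : 3 ≤ π 1) (i : Fin n) :
    coreDegree i ≤ π i := by
  rw [coreDegree]
  split_ifs with hi2 hi4
  · refine h1.trans (hπ.1 (Fin.le_def.2 ?_))
    rw [hπ.val_one]
    omega
  · exact hπ.two_le hi4
  · exact hπ.pos i

theorem one_le_sum_range_four (hπ : IsBicyclicDegreeSequence π) (htop : π ⊤ = 1) {e : ℕ → ℕ}
    (he : ∀ i : Fin n, coreDegree i + e i = π i) (hsum : ∑ k ∈ range n, e k + 4 = n) :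
    1 ≤ ∑ k ∈ range 4, e k := by
  by_contra! hzero
  have hn : 4 ≤ (⊤ : Fin n).val := le_of_not_gt fun hlt => by
    have := hπ.two_le hlt
    omega
  have hhead {k : ℕ} (hk : k < 4) : e k = 0 :=
    sum_eq_zero_iff.1 (Nat.lt_one_iff.1 hzero) k (mem_range.2 hk)
  have hle {k : ℕ} (hk4 : 4 ≤ k) (hkn : k < n) : e k ≤ 1 := by
    have h2 := he ⟨2, (by omega : 2 < n)⟩
    have hk := he ⟨k, hkn⟩
    have hanti := hπ.1 (show (⟨2, by omega⟩ : Fin n) ≤ ⟨k, hkn⟩ from Fin.mk_le_mk.2 (by omega))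
    rw [hhead (by norm_num)] at h2
    simp only [coreDegree] at h2 hk
    split_ifs at h2 hk <;> omega
  have hlast : e (⊤ : Fin n) = 0 := by
    have := he ⊤
    rw [coreDegree, if_neg (by omega), if_neg (by omega)] at this
    omega
  have hlt : ∑ k ∈ Ico 4 n, e k < #(Ico 4 n) • 1 := by
    rw [← sum_const]
    exact sum_lt_sum (fun k hk => hle (mem_Ico.1 hk).1 (mem_Ico.1 hk).2)
      ⟨_, mem_Ico.2 ⟨hn, (⊤ : Fin n).2⟩, by omega⟩
  rw [Nat.card_Ico, smul_eq_mul, mul_one] at hlt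
  have := sum_range_add_sum_Ico e hπ.four_le
  omega

theorem exists_parentGraph (hπ : IsBicyclicDegreeSequence π) (h1 : 3 ≤ π 1) (htop : π ⊤ = 1) :
    ∃ par : Fin n → Fin n, IsParentMap par ∧ MonotoneOn par {j | 4 ≤ j.val} ∧
      ∀ i : Fin n, coreDegree i + #{j : Fin n | 4 ≤ j.val ∧ par j = i} = π i := by
  obtain ⟨e, he⟩ : ∃ e : ℕ → ℕ, ∀ i : Fin n, coreDegree i + e i = π i :=
    ⟨Function.extend Fin.val (fun i => π i - coreDegree i) 0, fun i => by
      rw [Fin.val_injective.extend_apply, Nat.add_sub_of_le (hπ.coreDegree_le h1 i)]⟩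
  have hsum : ∑ k ∈ range n, e k + 4 = n := by
    have := hπ.sum_eq
    rw [← sum_congr rfl fun i _ => he i, sum_add_distrib, Fin.sum_univ_eq_sum_range,
      Fin.sum_univ_eq_sum_range, sum_coreDegree hπ.four_le] at this
    omega
  have hanti : AntitoneOn e (Set.Ico 4 n) := fun i hi j hj hij => by
    have := hπ.1 (show (⟨i, hi.2⟩ : Fin n) ≤ ⟨j, hj.2⟩ from hij)
    rw [← he, ← he, coreDegree, coreDegree, if_neg (by grind), if_neg (by grind),
      if_neg (by grind), if_neg (by grind)] at this
    exact Nat.le_of_add_le_add_left this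
  obtain ⟨par, hpar, hmono, hcard⟩ := exists_isParentMap_card_eq hsum fun j hj hjn =>
    lt_sum_range_add hanti hsum (hπ.one_le_sum_range_four htop he hsum) hj hjn
  exact ⟨par, hpar, hmono, fun i => by rw [hcard, he]⟩

end IsBicyclicDegreeSequence

theorem exists_isBM₁ {n : ℕ} [NeZero n] {π : Fin n → ℕ} (hπ : IsBicyclicDegreeSequence π)
    (h1 : 3 ≤ π 1) (htop : π ⊤ = 1) : ∃ B : SimpleGraph (Fin n), IsBM₁ π B := by
  classical
  have hn := hπ.four_le
  obtain ⟨par, hpar, hmono, hdeg⟩ := hπ.exists_parentGraph h1 htop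
  have hπdeg (i : Fin n) : (parentGraph par).degree i = π i := by
    rw [degree_parentGraph hpar hn, hdeg]
  obtain ⟨φ, hφ⟩ := exists_iso_baseGraph_parentGraph hpar hn
  have hanti : Antitone fun i => (parentGraph par).degree i := by
    simpa only [funext hπdeg] using hπ.1
  refine ⟨parentGraph par, Equiv.refl _, fun i => ?_,
    isBFSOrdering_parentGraph hpar hmono (by convert hanti) hn, φ, ?_⟩
  · convert hπdeg i
    rfl
  · have hofNat {k : ℕ} (hk : k < 4) : (Fin.castLE hn ⟨k, hk⟩ : Fin n) = Fin.ofNat n k :=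
      Fin.ext (Nat.mod_eq_of_lt (by omega)).symm
    exact ⟨(hφ 0).trans (hofNat (by omega)), (hφ 1).trans (hofNat (by omega)),
      (hφ 2).trans (hofNat (by omega)), (hφ 3).trans (hofNat (by omega))⟩

/-! ### Extremality -/

section IsBM

variable {n : ℕ} [NeZero n] {π : Fin n → ℕ} {V : Type*} [Fintype V] {B : SimpleGraph V}

theorem exists_isBM (hπ : IsBicyclicDegreeSequence π) : ∃ B : SimpleGraph (Fin n), IsBM π B := by
  have hn := hπ.four_le
  rcases hπ.cases with ⟨h1, htop⟩ | ⟨h0, h1, htop⟩ | hπ3 | hπ5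
  · obtain ⟨B, hB⟩ := exists_isBM₁ hπ h1 htop
    exact ⟨B, .inl ⟨hπ.1 (Fin.zero_le _), h1, htop, hB⟩⟩
  · have hlt := hπ.lt_card 0
    obtain ⟨B, hB⟩ := exists_isBM₂ (k := π 0 - 4) (n := n) (by omega) (by omega)
    rw [Nat.sub_add_cancel (by omega)] at hB
    exact ⟨B, .inr (.inl ⟨h0, h1, htop, hB⟩)⟩
  · have hlt := hπ.lt_card 0
    rw [hπ3, if_pos rfl] at hlt
    exact ⟨B₃ n 3, .inr (.inr (.inl ⟨hπ3, 3, le_rfl, hlt, ⟨.refl⟩⟩))⟩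
  · exact ⟨B₅ n 3, .inr (.inr (.inr ⟨hπ5, 3, le_rfl, hn, ⟨.refl⟩⟩))⟩

theorem IsBM.inGamma (h : IsBM π B) (hπ : IsBicyclicDegreeSequence π) : InGamma π B := by
  rcases h with ⟨-, -, -, h⟩ | ⟨h0, h1, -, h⟩ | ⟨hπ3, p, hp, hpn, ⟨e⟩⟩ | ⟨hπ5, p, hp, hpn, ⟨e⟩⟩
  · exact h.inGamma
  · exact h.inGamma hπ h0 h1
  · exact (inGamma_B₃ hπ3 hp hpn).of_iso e.symm
  · exact (inGamma_B₅ hπ5 hp hpn).of_iso e.symm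

theorem IsBM.attainsEdgeBounds [DecidableRel B.Adj] (h : IsBM π B)
    (hπ : IsBicyclicDegreeSequence π) : AttainsEdgeBounds B := by
  classical
  rcases h with ⟨-, -, -, h⟩ | ⟨-, -, -, h⟩ | ⟨-, p, hp, hpn, ⟨e⟩⟩ | ⟨-, p, hp, hpn, ⟨e⟩⟩
  · exact h.attainsEdgeBounds hπ
  · exact h.attainsEdgeBounds
  · exact (attainsEdgeBounds_B₃ hp hpn).of_iso e.symm
  · exact (attainsEdgeBounds_B₅ hp hpn).of_iso e.symm

theorem IsBM.connectivity_le {W : Type*} [Fintype W] {G : SimpleGraph W} (h : IsBM π B)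
    (hπ : IsBicyclicDegreeSequence π) {f : ℝ → ℝ → ℝ} (hf : IsEscalatingOnNat f)
    (hG : InGamma π G) : connectivity f G ≤ connectivity f B := by
  classical
  have hB := (h.inGamma hπ).2
  refine Bicyclic.connectivity_le hf hG.2 hB fun s t hts =>
    (hπ.isBicyclic hG).card_interedges_le (degreeAtLeast_antitone hts) ?_ ?_ ?_
      (h.attainsEdgeBounds hπ s t hts)
  · rw [hG.2.card_degreeAtLeast, hB.card_degreeAtLeast]
  · rw [hG.2.card_degreeAtLeast, hB.card_degreeAtLeast]
  · rw [hG.2.sum_degree_degreeAtLeast, hB.sum_degree_degreeAtLeast]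

theorem IsBM.le_connectivity {W : Type*} [Fintype W] {G : SimpleGraph W} (h : IsBM π B)
    (hπ : IsBicyclicDegreeSequence π) {f : ℝ → ℝ → ℝ} (hf : IsEscalatingOnNat (-f))
    (hG : InGamma π G) : connectivity f B ≤ connectivity f G := by
  simpa only [connectivity_neg, neg_le_neg_iff] using h.connectivity_le hπ hf hG

end IsBM

end Bicyclic

theorem mainTheorem2_general {n : ℕ} [NeZero n] {π : Fin n → ℕ}
    (hπ : Bicyclic.IsBicyclicDegreeSequence π) :
    (∃ B : SimpleGraph (Fin n), Bicyclic.IsBM π B) ∧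
    ∀ (V : Type u) [Fintype V] (B : SimpleGraph V), Bicyclic.IsBM π B →
      Bicyclic.InGamma π B ∧
      ∀ (f : ℝ → ℝ → ℝ) (W : Type v) [Fintype W] (G : SimpleGraph W), Bicyclic.InGamma π G →
        (Bicyclic.IsEscalatingOnNat f → Bicyclic.connectivity f G ≤ Bicyclic.connectivity f B) ∧
        (Bicyclic.IsEscalatingOnNat (-f) →
          Bicyclic.connectivity f B ≤ Bicyclic.connectivity f G) :=
  ⟨Bicyclic.exists_isBM hπ, fun _ _ _ hB => ⟨hB.inGamma hπ, fun _ _ _ _ hG =>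
    ⟨fun hf => hB.connectivity_le hπ hf hG, fun hf => hB.le_connectivity hπ hf hG⟩⟩⟩

theorem mainTheorem2 {n : ℕ} [NeZero n] (π : Fin n → ℕ)
    (hπ : Bicyclic.IsBicyclicDegreeSequence π) :
    (∃ B : SimpleGraph (Fin n), Bicyclic.IsBM π B) ∧
    ∀ (V : Type u) [Fintype V] (B : SimpleGraph V), Bicyclic.IsBM π B →
      ∀ f : ℝ → ℝ → ℝ, Bicyclic.IsExtremal f π B :=
  (mainTheorem2_general hπ).imp_right fun hB V _ B h f =>
    ⟨(hB V B h).1, fun hf W _ G hG => ((hB V B h).2 f W G hG).1 hf.isEscalatingOnNat,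
      fun hf W _ G hG => ((hB V B h).2 f W G hG).2 hf.neg.isEscalatingOnNat⟩
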